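/- **Types.** Let $\mathcal S$ be a set of labels of non-trivial quantum systems; system $A\in\mathcal S$ has Hilbert space $\mathcal H_A=\mathbb C^{d_A}$, $2\le d_A<\infty$, with its standard basis. An elementary type is a finite set of systems, i.e. the composite system $A_1\cdots A_n$ with Hilbert space $\mathcal H_{A_1}\otimes\cdots\otimes\mathcal H_{A_n}$; the empty one is the trivial (one-dimensional) type $I$. Types are generated from elementary types by $(x,y)\mapsto (x\to y)$. Put $\overline x:=x\to I$ and $x\otimes y:=\overline{x\to\overline y}$. $\mathsf{Ele}_x$ is the set of non-trivial systems occurring in $x$; no label occurs twice in a type. Maps of type $x$ are (Choi) operators on $\mathcal H_x=\bigotimes_{A\in\mathsf{Ele}_x}\mathcal H_A$, where $M$ of type $x\to y$ stands for the linear map $\mathcal M(\rho)=\operatorname{Tr}_x[(\rho^{T}\otimes 1)M]$. **Deterministic maps.** For a (finite-dimensional, non-zero) elementary system $E$ the extension $x\|E$ is defined by $A\|E:=AE$ and $(x\to y)\|E:=x\to(y\|E)$. A map of elementary type is deterministic if it is positive semidefinite with trace $1$, and admissible if it is positive semidefinite and bounded above by a deterministic one. A map $M$ of type $x\to y$ is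 admissible if (i) for all elementary $E$, $\mathcal M\otimes\mathcal I_E$ sends admissible maps of type $x\|E$ to admissible maps of type $y\|E$, and (ii) there are finitely many $N_1,\dots,N_n$ satisfying (i) such that for all $E$, $(\mathcal M+\sum_i\mathcal N_i)\otimes\mathcal I_E$ sends deterministic maps of type $x\|E$ to deterministic maps of type $y\|E$. It is deterministic if it is admissible and, for all $E$, $\mathcal M\otimes\mathcal I_E$ sends deterministic maps of type $x\|E$ to deterministic maps of type $y\|E$. Let $\mathsf T_1(x)$ be the set of deterministic maps of type $x$. **Composition and contraction.** For operators $R$, $S$ on sets of systems whose intersection is $\mathsf H$, the link product is $R*S:=\operatorname{Tr}_{\mathsf H}[(R\otimes 1)(S^{T_{\mathsf H}}\otimes 1)]$, with $T_{\mathsf H}$ the partial transpose on $\mathsf H$. The composition $x*y$ is admissible if for all $R\in\mathsf T_1(x)$, $S\in\mathsf T_1(y)$ there is a type $z$ with $R*S\in\mathsf T_1(z)$. For systems $A,B$ of equal dimension let $\mathcal C_{A,B}(R):=R*\Phi_{AB}$, $\Phi_{AB}:=\sum_{i,j}|ii\rangle\langle jj|$. For a set $\mathsf H=\{(A_1,B_1),\dots,(A_n,B_n)\}$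 of mutually disjoint pairs of systems of equal dimension in $\mathsf{Ele}_w$, the multiple contraction $\mathcal C_{\mathsf H}(w)$ is admissible if for every $R\in\mathsf T_1(w)$ there is a type $z$ with $\mathcal C_{\mathsf H}(R):=\mathcal C_{A_1,B_1}(\cdots\mathcal C_{A_n,B_n}(R)\cdots)\in\mathsf T_1(z)$. **Statement.** Let $x$ and $y$ be types, in each of which no label of a non-trivial system occurs more than once (they may share labels). In $x\otimes y$, relabel the systems so that the system $A$ of $x$ and the system $A$ of $y$ become two distinct copies $A'$ and $A''$ of $A$, and let $\mathsf H:=\{(A',A''):A\in\mathsf{Ele}_x\cap\mathsf{Ele}_y\}$. Then, in whatever order the contractions in $\mathsf H$ are performed, the composition $x*y$ is admissible if and only if the multiple contraction $\mathcal C_{\mathsf H}(x\otimes y)$ is admissible. -/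

import Mathlib

open scoped Matrix ComplexOrder

noncomputable section

/-! ## Types

`ι` is a set of labels of non-trivial elementary quantum systems; system `i` has Hilbert space
`ℂ ^ (d i)` with its standard basis, where `d : ι → ℕ`. -/

/-- Types. The elementary types are the (possibly composite) systems `A₁A₂⋯Aₙ`, given by the
finite set `{A₁, …, Aₙ}` of their labels; the empty set gives the trivial system `I`. -/
inductive HType (ι : Type) : Type
  | elem (S : Finset ι) : HType ι
  | arrow (x y : HType ι) : HType ι

namespace HType

variable {ι : Type}

/-- The trivial type `I`. -/
def triv : HType ι := elem ∅

/-- `x̄ := x → I`. -/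
def dual (x : HType ι) : HType ι := arrow x triv

/-- `x ⊗ y := \overline{x → ȳ}`. -/
def tensor (x y : HType ι) : HType ι := dual (arrow x (dual y))

/-- The labels of the non-trivial elementary systems occurring in a type. -/
def ele [DecidableEq ι] : HType ι → Finset ι
  | elem S => S
  | arrow x y => ele x ∪ ele y

/-- No label of a non-trivial elementary system occurs more than once in the type. -/
def LabelsDistinct [DecidableEq ι] : HType ι → Prop
  | elem _ => True
  | arrow x y => LabelsDistinct x ∧ LabelsDistinct y ∧ Disjoint (ele x) (ele y)

/-- Renaming the labels of a type. -/
def relabel {κ : Type} (f : ι ↪ κ) : HType ι → HType κ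
  | elem S => elem (S.map f)
  | arrow x y => arrow (relabel f x) (relabel f y)

/-- The index set of the product basis of `H_x`: the basis of `⨂_{i ∈ S} ℂ ^ (d i)` for an
elementary type, and that of `H_x ⊗ H_y` for `x → y`. -/
def Idx (d : ι → ℕ) : HType ι → Type
  | elem S => (i : S) → Fin (d i)
  | arrow x y => Idx d x × Idx d y

instance instFintypeIdx [DecidableEq ι] (d : ι → ℕ) : (x : HType ι) → Fintype (Idx d x)
  | elem S => inferInstanceAs (Fintype ((i : S) → Fin (d i)))
  | arrow x y =>
    haveI := instFintypeIdx d x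
    haveI := instFintypeIdx d y
    inferInstanceAs (Fintype (Idx d x × Idx d y))

end HType

/-! ## Admissible and deterministic maps -/

/-- Let `M` be the Choi operator of a linear map `𝓜 : L(H_a) → L(H_b ⊗ H_E)`. This is the action of
`𝓜 ⊗ 𝓘_F : L(H_a ⊗ H_F) → L(H_b ⊗ H_E ⊗ H_F)`, obtained from `𝓜(ρ) = Tr_a[(ρᵀ ⊗ 1) M]`. -/
def applyExt {a b E F : Type} [Fintype a]
    (M : Matrix ((a × b) × E) ((a × b) × E) ℂ) (ρ : Matrix (a × F) (a × F) ℂ) :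
    Matrix (b × (E × F)) (b × (E × F)) ℂ :=
  fun p q => ∑ s : a, ∑ t : a,
    ρ (s, p.2.2) (t, q.2.2) * M ((s, p.1), p.2.1) ((t, q.1), q.2.1)

/-- A set of operators on `H_a ⊗ H_F` for every (non-zero, finite-dimensional) system `F`. -/
abbrev ExtFamily (a : Type) : Type 1 :=
  (F : Type) → [Fintype F] → [Nonempty F] → Set (Matrix (a × F) (a × F) ℂ)

/-- For every elementary system `F`, the map `𝓜 ⊗ 𝓘_F` with `𝓜` of Choi operator `M` sends the
operators of `P` on `H_a ⊗ H_F` to operators of `Q` on `H_b ⊗ H_E ⊗ H_F`. -/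
def CompletelyMaps {a b E : Type} [Fintype a] [Fintype E] [Nonempty E]
    (P : ExtFamily a) (Q : ExtFamily b) (M : Matrix ((a × b) × E) ((a × b) × E) ℂ) : Prop :=
  ∀ (F : Type) [Fintype F] [Nonempty F], ∀ ρ ∈ P F, applyExt M ρ ∈ Q (E × F)

/-- Admissibility of a map `M` of type `x → (y || E)`, given the admissible maps `Ax`, `Ay` and the
deterministic maps `Dx`, `Dy` of the extensions of `x` and of `y`: (i) `M` completely preserves
admissible maps; (ii) there are finitely many `N i` satisfying (i) such that `M + ∑ i, N i`
completely preserves deterministic maps. -/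
def AdmArrow {a b E : Type} [Fintype a] [Fintype E] [Nonempty E]
    (Ax Dx : ExtFamily a) (Ay Dy : ExtFamily b)
    (M : Matrix ((a × b) × E) ((a × b) × E) ℂ) : Prop :=
  CompletelyMaps Ax Ay M ∧
    ∃ (n : ℕ) (N : Fin n → Matrix ((a × b) × E) ((a × b) × E) ℂ),
      (∀ i, CompletelyMaps Ax Ay (N i)) ∧ CompletelyMaps Dx Dy (M + ∑ i, N i)

/-- Deterministic states: positive operators of unit trace. -/
def IsState {n : Type} [Fintype n] (ρ : Matrix n n ℂ) : Prop :=
  ρ.PosSemidef ∧ ρ.trace = 1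

section
variable {ι : Type} [DecidableEq ι] (d : ι → ℕ)

mutual

/-- The admissible maps of type `x || E`, the extension of `x` by an elementary system with basis
`E`. The extension obeys `A || E = AE`, `(x → y) || E = x → (y || E)` and
`(y || E) || F = y || EF`; operators of type `x || E` act on `H_x ⊗ H_E`. -/
def Adm : (x : HType ι) → ExtFamily (HType.Idx d x)
  | .elem _ => fun _ _ _ => {M | M.PosSemidef ∧ ∃ N, IsState N ∧ (N - M).PosSemidef}
  | .arrow x y => fun _ _ _ => {M | AdmArrow (Adm x) (Det x) (Adm y) (Det y) M}

/-- The deterministic maps of type `x || E`; for a non-elementary type these are the admissible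
maps which completely preserve deterministic maps. -/
def Det : (x : HType ι) → ExtFamily (HType.Idx d x)
  | .elem _ => fun _ _ _ => {M | IsState M}
  | .arrow x y => fun _ _ _ =>
    {D | AdmArrow (Adm x) (Det x) (Adm y) (Det y) D ∧ CompletelyMaps (Det x) (Det y) D}

end

/-! ## Labelled operators and the link product -/

/-- Basis labels of `H_S = ⨂_{i ∈ S} ℂ ^ (d i)`. -/
abbrev Cfg (S : Finset ι) : Type := (i : S) → Fin (d i)

variable {d} in
/-- Restriction of a basis label to a subset of the systems. -/
def Cfg.restrict {S U : Finset ι} (h : S ⊆ U) (c : Cfg d U) : Cfg d S :=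
  fun i => c ⟨i, h i.2⟩

/-- Operators on `H_S`. -/
abbrev Op (S : Finset ι) : Type := Matrix (Cfg d S) (Cfg d S) ℂ

/-- An operator together with the set of systems on which it acts. -/
structure LabelledOp where
  supp : Finset ι
  op : Op d supp

/-- The identification of `⨂_{i ∈ Ele_x} H_i` with `H_x`, on basis labels (a bijection when the
labels of `x` are distinct). -/
def HType.read : (x : HType ι) → Cfg d x.ele → HType.Idx d x
  | .elem _, c => c
  | .arrow x y, c =>
    (HType.read x (Cfg.restrict (U := x.ele ∪ y.ele) Finset.subset_union_left c),
      HType.read y (Cfg.restrict (U := x.ele ∪ y.ele) Finset.subset_union_right c))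

/-- The set `T₁(x)` of deterministic maps of type `x`, as operators on `⨂_{i ∈ Ele_x} H_i`. (The
type `x` is its own extension by the trivial system.) -/
def T1 (x : HType ι) : Set (LabelledOp d) :=
  {R | ∃ M ∈ Det d x Unit,
    R = ⟨x.ele, M.submatrix (fun c => (x.read d c, ())) (fun c => (x.read d c, ()))⟩}

variable {d}

/-- `M ⊗ 1_{U \ S}`, for `M` acting on `S ⊆ U`. -/
def pad {S U : Finset ι} (h : S ⊆ U) (M : Op d S) : Op d U :=
  fun c c' => if ∀ i : U, (i : ι) ∉ S → c i = c' i then M (c.restrict h) (c'.restrict h) else 0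

/-- Partial transpose on the systems in `H`. -/
def partialTranspose (H : Finset ι) {S : Finset ι} (M : Op d S) : Op d S :=
  fun c c' => M (fun i => if (i : ι) ∈ H then c' i else c i)
    (fun i => if (i : ι) ∈ H then c i else c' i)

/-- The basis label equal to `h` on `H` and to `c` elsewhere. -/
def glue {U H : Finset ι} (c : Cfg d (U \ H)) (h : Cfg d H) : Cfg d U :=
  fun i => if hi : (i : ι) ∈ H then h ⟨i, hi⟩ else c ⟨i, Finset.mem_sdiff.2 ⟨i.2, hi⟩⟩

/-- Partial trace over the systems in `H ⊆ U`. -/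
def partialTrace {U : Finset ι} (H : Finset ι) (M : Op d U) : Op d (U \ H) :=
  fun c c' => ∑ h : Cfg d H, M (glue c h) (glue c' h)

/-- The link product
`R * T = Tr_H[(R ⊗ 1) (T^{θ_H} ⊗ 1)]`, with `H` the set of systems shared by `R` and `T`. -/
def link (R T : LabelledOp d) : LabelledOp d where
  supp := (R.supp ∪ T.supp) \ (R.supp ∩ T.supp)
  op := partialTrace (R.supp ∩ T.supp)
    (pad (U := R.supp ∪ T.supp) Finset.subset_union_left R.op *
      pad (U := R.supp ∪ T.supp) Finset.subset_union_right
        (partialTranspose (R.supp ∩ T.supp) T.op))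

/-- `Φ_{AB} = ∑_{i,j} |ii⟩⟨jj|` on `H_A ⊗ H_B` (for systems `A`, `B` of equal dimension). -/
def Phi (A B : ι) : LabelledOp d where
  supp := {A, B}
  op := fun c c' =>
    if (c ⟨A, by simp⟩ : ℕ) = c ⟨B, by simp⟩ ∧ (c' ⟨A, by simp⟩ : ℕ) = c' ⟨B, by simp⟩
    then 1 else 0

/-- `C_{A,B}(R) = R * Φ_{AB}`. -/
def contract (A B : ι) (R : LabelledOp d) : LabelledOp d := link R (Phi A B)

/-- `C_{A₁,B₁}(C_{A₂,B₂}(⋯ C_{Aₙ,Bₙ}(R) ⋯))` for the list `(A₁,B₁), …, (Aₙ,Bₙ)`. -/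
def contractAll (L : List (ι × ι)) (R : LabelledOp d) : LabelledOp d :=
  L.foldr (fun p T => contract p.1 p.2 T) R

/-! ## Admissible compositions and contractions -/

variable (d)

/-- The composition `x * y` is admissible. -/
def CompositionAdmissible (x y : HType ι) : Prop :=
  ∀ R ∈ T1 d x, ∀ S ∈ T1 d y, ∃ z : HType ι, z.LabelsDistinct ∧ link R S ∈ T1 d z

/-- The multiple contraction, along the mutually disjoint pairs in `L`, of the type `w` is
admissible. -/
def ContractionAdmissible (w : HType ι) (L : List (ι × ι)) : Prop :=
  ∀ R ∈ T1 d w, ∃ z : HType ι, z.LabelsDistinct ∧ contractAll L R ∈ T1 d z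

end

section
variable {ι : Type} [DecidableEq ι]

/-- `x ⊗ y` for types that may share labels: label `A` of `x` becomes `inl A` and label `A` of `y`
becomes `inr A`, so that the two copies of a shared system are told apart. -/
def HType.disjointTensor (x y : HType ι) : HType (ι ⊕ ι) :=
  HType.tensor (x.relabel Function.Embedding.inl) (y.relabel Function.Embedding.inr)

/-- The pairs formed by the two copies, in `x ⊗ y`, of a system shared by `x` and `y`. -/
def sharedPairs (x y : HType ι) : Finset ((ι ⊕ ι) × (ι ⊕ ι)) :=
  (x.ele ∩ y.ele).image fun A => (Sum.inl A, Sum.inr A)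

end

end

-- The recursive definition of determinism collapses to a linear condition: a map of type `x || F`
-- is deterministic exactly when it is positive semidefinite and its partial trace over `F` lies in
-- an affine space `aff d x` depending only on `x` (`HType.mem_det_and_mem_adm`). Two facts drive
-- the induction. Feeding the maximally entangled operator to a map returns its Choi operator, so
-- preservation of admissibility forces positivity. A positive multiple of the identity lies in
-- every `aff d x`, so the positive elements of `aff d x` determine it, and it suffices to test
-- positive inputs.
--
-- The bipolar argument then shows that every deterministic `W` of type `x ⊗ y` is an affine
-- combination, with possibly complex weights, of products `R ⊗ S` of deterministic maps.
-- Contracting the shared systems of `R ⊗ S` gives the link product `R * S` up to a renaming of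
-- labels. Applied to products, this already shows that an admissible contraction gives an
-- admissible composition.
--
-- For the converse, let `W = ∑ w k • (R k ⊗ S k)`. Each `R k * S k` is deterministic of some type,
-- but that type may vary with `k`, and such a combination is useless. To find a common type, put
-- all the `R i` on one curve of convex combinations, with weights proportional to `t ^ i`, and all
-- the `S j` on another, with weights proportional to `t ^ (n * j)`. Each `t > 0` yields a type with
-- labels in a fixed finite set. There are only countably many such types, so one type `z` occurs
-- for infinitely many `t`. The affine constraints of `z` are then polynomial identities in `t`, and
-- since the exponents `i + n * j` are distinct, every `R i * S j` lies in `aff d z`. Hence so does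
-- the contraction of `W`. Its positivity comes from that of `W` itself, not from the decomposition.

/-! ## Positive semidefinite matrices -/

/-- This is the compression of `M` by the vectors `∑ h, e (f p h)`. Both the action of a positive
Choi operator and a contraction have this shape, so it is the source of positivity for both. -/
theorem Matrix.PosSemidef.sum_sum_apply {n m κ : Type} [Fintype n] [Fintype m] [Fintype κ]
    {M : Matrix m m ℂ} (hM : M.PosSemidef) (f : n → κ → m) :
    Matrix.PosSemidef (fun p q : n => ∑ h, ∑ h', M (f p h) (f q h') : Matrix n n ℂ) := by
  classical
  let V : Matrix (n × κ) n ℂ := fun r p => if r.1 = p then 1 else 0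
  have e : Matrix.of (fun p q : n => ∑ h, ∑ h', M (f p h) (f q h')) =
      Vᴴ * M.submatrix (fun r : n × κ => f r.1 r.2) (fun r : n × κ => f r.1 r.2) * V := by
    ext p q
    have hV : ∀ r p, V r p = if r.1 = p then 1 else 0 := fun _ _ => rfl
    simp [hV, Matrix.mul_apply, Fintype.sum_prod_type, Matrix.conjTranspose_apply, apply_ite]
    exact Finset.sum_comm
  change (Matrix.of fun p q : n => ∑ h, ∑ h', M (f p h) (f q h')).PosSemidef
  rw [e]
  exact (hM.submatrix _).conjTranspose_mul_mul_same V

open scoped MatrixOrder Matrix.Norms.L2Operator in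
theorem Matrix.IsHermitian.exists_smul_one_sub_posSemidef {n : Type} [Fintype n] [DecidableEq n]
    {A : Matrix n n ℂ} (hA : A.IsHermitian) :
    ∃ r : ℝ, 0 < r ∧ ((r : ℂ) • (1 : Matrix n n ℂ) - A).PosSemidef := by
  have h := IsSelfAdjoint.le_algebraMap_norm_self (a := A) hA
  rw [Matrix.le_iff] at h
  -- The extra `1` keeps the constant strictly positive when `A = 0`.
  refine ⟨‖A‖ + 1, by positivity, ?_⟩
  have h1 : (1 : Matrix n n ℂ).PosSemidef := Matrix.PosSemidef.one
  have e : ((‖A‖ + 1 : ℝ) : ℂ) • (1 : Matrix n n ℂ) - A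
      = (algebraMap ℝ (Matrix n n ℂ)) ‖A‖ - A + 1 := by
    rw [Algebra.algebraMap_eq_smul_one]
    ext i j
    simp only [Matrix.sub_apply, Matrix.add_apply, Matrix.smul_apply, Matrix.one_apply,
      smul_eq_mul, Complex.real_smul]
    push_cast
    ring
  exact e ▸ h.add h1

/-! ## The linear map of a Choi operator -/

section
variable {a b E F : Type}

/-- The partial trace over the second factor. -/
def ptrace [Fintype E] (M : Matrix (a × E) (a × E) ℂ) : Matrix a a ℂ := fun s t => ∑ e, M (s, e) (t, e)

/-- `𝓜(ρ) = Tr_a[(ρᵀ ⊗ 1) M]`, as a bilinear function of `ρ` and `M`. -/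
def choiApply [Fintype a] : Matrix a a ℂ →ₗ[ℂ] Matrix (a × b) (a × b) ℂ →ₗ[ℂ] Matrix b b ℂ :=
  LinearMap.mk₂ ℂ (fun ρ M p q => ∑ s, ∑ t, ρ s t * M (s, p) (t, q))
    (fun ρ σ M => by
      ext; simp only [Matrix.add_apply, add_mul, Finset.sum_add_distrib]; rfl)
    (fun c ρ M => by
      ext; simp only [Matrix.smul_apply, smul_eq_mul, mul_assoc, ← Finset.mul_sum]; rfl)
    (fun ρ M N => by
      ext; simp only [Matrix.add_apply, mul_add, Finset.sum_add_distrib]; rfl)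
    (fun c ρ M => by
      ext; simp only [Matrix.smul_apply, smul_eq_mul, mul_left_comm _ c, ← Finset.mul_sum]; rfl)

theorem choiApply_apply [Fintype a] (ρ : Matrix a a ℂ) (M : Matrix (a × b) (a × b) ℂ) (p q : b) :
    choiApply ρ M p q = ∑ s, ∑ t, ρ s t * M (s, p) (t, q) := rfl

theorem choiApply_conjTranspose [Fintype a] (ρ : Matrix a a ℂ) (M : Matrix (a × b) (a × b) ℂ) :
    choiApply ρ Mᴴ = (choiApply ρᴴ M)ᴴ := by
  ext p q
  simp only [choiApply_apply, Matrix.conjTranspose_apply, star_sum, star_mul', star_star]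
  exact Finset.sum_comm

theorem choiApply_smul_one [Fintype a] [DecidableEq a] [DecidableEq b] (ρ : Matrix a a ℂ) (c : ℂ) :
    choiApply ρ (c • (1 : Matrix (a × b) (a × b) ℂ)) = (ρ.trace * c) • (1 : Matrix b b ℂ) := by
  ext p q
  by_cases h : p = q
  · subst h; simp [choiApply_apply, Matrix.one_apply, Matrix.trace, Finset.sum_mul]
  · simp [choiApply_apply, h]

theorem trace_choiApply_smul_one [Fintype a] [Fintype b]
    [DecidableEq a] (M : Matrix (a × b) (a × b) ℂ) (c : ℂ) :
    (choiApply (c • (1 : Matrix a a ℂ)) M).trace = c * M.trace := by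
  simp only [Matrix.trace, Matrix.diag, choiApply_apply, Matrix.smul_apply, Matrix.one_apply,
    smul_eq_mul, mul_ite, mul_one, mul_zero, ite_mul, zero_mul, Finset.sum_ite_eq,
    Finset.mem_univ, if_true, Fintype.sum_prod_type, Finset.mul_sum]
  exact Finset.sum_comm

theorem ptrace_applyExt [Fintype a] [Fintype E] [Fintype F]
    (M : Matrix ((a × b) × E) ((a × b) × E) ℂ)
    (ρ : Matrix (a × F) (a × F) ℂ) :
    ptrace (applyExt M ρ) = choiApply (ptrace ρ) (ptrace M) := by
  ext p q
  simp only [ptrace, applyExt, choiApply_apply, Finset.sum_mul, Finset.mul_sum,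
    Fintype.sum_prod_type]
  simp only [Finset.sum_comm (s := (Finset.univ : Finset E)),
    Finset.sum_comm (s := (Finset.univ : Finset F)) (t := (Finset.univ : Finset a))]

theorem applyExt_posSemidef [Fintype a] [Fintype b] [Fintype E] [Fintype F]
    {M : Matrix ((a × b) × E) ((a × b) × E) ℂ} (hM : M.PosSemidef)
    {ρ : Matrix (a × F) (a × F) ℂ} (hρ : ρ.PosSemidef) : (applyExt M ρ).PosSemidef :=
  (hρ.kronecker hM).sum_sum_apply
    (fun (p : b × (E × F)) (s : a) => ((s, p.2.2), ((s, p.1), p.2.1)))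

end

/-! ## The affine space of a type -/

namespace HType
variable {ι : Type} [DecidableEq ι] (d : ι → ℕ)

instance instDecidableEqIdx {ι : Type} (d : ι → ℕ) : (x : HType ι) → DecidableEq (Idx d x)
  | elem S => inferInstanceAs (DecidableEq ((i : S) → Fin (d i)))
  | arrow x y =>
    haveI := instDecidableEqIdx d x
    haveI := instDecidableEqIdx d y
    inferInstanceAs (DecidableEq (Idx d x × Idx d y))

theorem nonempty_idx {ι : Type} {d : ι → ℕ} (hd : ∀ i, 0 < d i) : ∀ x : HType ι, Nonempty (Idx d x)
  | elem _ => ⟨fun i => ⟨0, hd i⟩⟩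
  | arrow x y =>
    let ⟨p⟩ := nonempty_idx hd x
    let ⟨q⟩ := nonempty_idx hd y
    ⟨(p, q)⟩

/-- Linear functionals which take the value `1` exactly on the affine span of the deterministic
maps of a type. -/
def constraints : (x : HType ι) → Set (Matrix (Idx d x) (Idx d x) ℂ →ₗ[ℂ] ℂ)
  | elem S => {Matrix.traceLinearMap (Idx d (elem S)) ℂ ℂ}
  | arrow x y => {ψ : Matrix (Idx d x × Idx d y) (Idx d x × Idx d y) ℂ →ₗ[ℂ] ℂ |
      ∃ ρ : Matrix (Idx d x) (Idx d x) ℂ, (∀ φ ∈ constraints x, φ ρ = 1) ∧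
        ∃ φ ∈ constraints y, ψ = φ ∘ₗ choiApply ρ}

/-- The affine span of the deterministic maps of type `x`. -/
def aff (x : HType ι) : Set (Matrix (Idx d x) (Idx d x) ℂ) := {M | ∀ φ ∈ constraints d x, φ M = 1}

variable {d}

theorem mem_aff_elem {S : Finset ι} {M : Matrix (Idx d (elem S)) (Idx d (elem S)) ℂ} :
    M ∈ aff d (elem S) ↔ M.trace = 1 := by
  simp [aff, constraints]

theorem mem_aff_arrow {x y : HType ι}
    {M : Matrix (Idx d x × Idx d y) (Idx d x × Idx d y) ℂ} :
    (M : Matrix (Idx d (arrow x y)) (Idx d (arrow x y)) ℂ) ∈ aff d (arrow x y) ↔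
      ∀ ρ ∈ aff d x, choiApply ρ M ∈ aff d y := by
  constructor
  · intro h ρ hρ φ hφ
    exact h (φ ∘ₗ choiApply ρ) ⟨ρ, hρ, φ, hφ, rfl⟩
  · rintro h _ ⟨ρ, hρ, φ, hφ, rfl⟩
    exact h ρ hρ φ hφ

theorem sum_smul_mem_aff {x : HType ι} {κ : Type} (s : Finset κ) {c : κ → ℂ}
    {M : κ → Matrix (Idx d x) (Idx d x) ℂ} (hc : ∑ k ∈ s, c k = 1)
    (hM : ∀ k ∈ s, M k ∈ aff d x) : ∑ k ∈ s, c k • M k ∈ aff d x := by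
  intro φ hφ
  rw [map_sum, ← hc]
  refine Finset.sum_congr rfl fun k hk => ?_
  rw [map_smul, hM k hk φ hφ, smul_eq_mul, mul_one]

theorem conjTranspose_mem_aff : ∀ {x : HType ι} {M : Matrix (Idx d x) (Idx d x) ℂ},
    M ∈ aff d x → Mᴴ ∈ aff d x
  | elem _, M, h => by
    rw [mem_aff_elem] at h ⊢
    rw [Matrix.trace_conjTranspose, h, star_one]
  | arrow x y, M, h => by
    refine mem_aff_arrow.2 fun ρ hρ => ?_
    have h1 := conjTranspose_mem_aff (mem_aff_arrow.1 h _ (conjTranspose_mem_aff hρ))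
    exact choiApply_conjTranspose (b := Idx d y) ρ M ▸ h1

/-- The trace clause is what makes the induction work: for an arrow, the image of an input under a
multiple of the identity depends only on the input's trace, which must therefore be constant on `aff
d x`. -/
theorem exists_smul_one_mem_aff (hd : ∀ i, 0 < d i) : ∀ x : HType ι, ∃ c : ℝ, 0 < c ∧
    (c : ℂ) • (1 : Matrix (Idx d x) (Idx d x) ℂ) ∈ aff d x ∧
    ∀ M ∈ aff d x, M.trace = c * Fintype.card (Idx d x)
  | elem S => by
    have := nonempty_idx hd (elem S)
    have h0 : (Fintype.card (Idx d (elem S)) : ℂ) ≠ 0 := by exact_mod_cast Fintype.card_ne_zero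
    have h1 : 0 < (Fintype.card (Idx d (elem S)) : ℝ) := by exact_mod_cast Fintype.card_pos
    refine ⟨(Fintype.card (Idx d (elem S)) : ℝ)⁻¹, by positivity, ?_, fun M hM => ?_⟩
    · rw [mem_aff_elem, Matrix.trace_smul, Matrix.trace_one]
      push_cast
      exact inv_mul_cancel₀ h0
    · rw [mem_aff_elem.1 hM]
      push_cast
      exact (inv_mul_cancel₀ h0).symm
  | arrow x y => by
    obtain ⟨c, hc, hc1, hct⟩ := exists_smul_one_mem_aff hd x
    obtain ⟨k, hk, hk1, hkt⟩ := exists_smul_one_mem_aff hd y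
    have := nonempty_idx hd x
    have h0 : (Fintype.card (Idx d x) : ℂ) ≠ 0 := by exact_mod_cast Fintype.card_ne_zero
    have h1 : 0 < (Fintype.card (Idx d x) : ℝ) := by exact_mod_cast Fintype.card_pos
    have hc0 : (c : ℂ) ≠ 0 := by exact_mod_cast hc.ne'
    -- Inputs have trace `c * card`, so this multiple of the identity sends each of them to `k • 1`.
    refine ⟨k / (c * Fintype.card (Idx d x)), by positivity, ?_, fun M hM => ?_⟩
    · have : (((k / (c * Fintype.card (Idx d x)) : ℝ) : ℂ) •
          (1 : Matrix (Idx d x × Idx d y) (Idx d x × Idx d y) ℂ) :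
            Matrix (Idx d (arrow x y)) (Idx d (arrow x y)) ℂ) ∈ aff d (arrow x y) := by
        refine mem_aff_arrow.2 fun ρ hρ => ?_
        rw [choiApply_smul_one, hct ρ hρ]
        convert hk1 using 2
        push_cast
        field_simp
      exact this
    · have h2 := hkt _ (mem_aff_arrow.1 hM _ hc1)
      have h3 := trace_choiApply_smul_one
        (M : Matrix (Idx d x × Idx d y) (Idx d x × Idx d y) ℂ) c
      rw [h3] at h2
      have h4 : (Fintype.card (Idx d (arrow x y)) : ℂ)
          = Fintype.card (Idx d x) * Fintype.card (Idx d y) := by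
        have := Fintype.card_prod (Idx d x) (Idx d y)
        exact_mod_cast this
      rw [h4]
      push_cast
      change (c : ℂ) * M.trace = _ at h2
      field_simp
      rw [mul_comm, h2]

theorem exists_posSemidef_mem_aff (hd : ∀ i, 0 < d i) (x : HType ι) :
    ∃ M : Matrix (Idx d x) (Idx d x) ℂ, M.PosSemidef ∧ M ∈ aff d x := by
  obtain ⟨c, hc, h, -⟩ := exists_smul_one_mem_aff hd x
  refine ⟨_, Matrix.PosSemidef.one.smul ?_, h⟩
  exact_mod_cast hc.le

/-- A linear functional equal to `1` on the positive elements of `aff d x` is `1` on `aff d x`. -/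
theorem eq_one_of_forall_posSemidef (hd : ∀ i, 0 < d i) {x : HType ι}
    (φ : Matrix (Idx d x) (Idx d x) ℂ →ₗ[ℂ] ℂ)
    (hφ : ∀ M ∈ aff d x, M.PosSemidef → φ M = 1) {M : Matrix (Idx d x) (Idx d x) ℂ}
    (hM : M ∈ aff d x) : φ M = 1 := by
  obtain ⟨c, hc, hc1, -⟩ := exists_smul_one_mem_aff hd x
  have hφc := hφ _ hc1 (Matrix.PosSemidef.one.smul (by exact_mod_cast hc.le))
  -- For large `r` the operator `r • 1 + A` is positive. Rescaled by `c / (r + c)`, it is an affine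
  -- combination of `c • 1` and `A` in which `A` has nonzero weight, so the value at `A` can be
  -- solved for.
  have key : ∀ A ∈ aff d x, A.IsHermitian → φ A = 1 := by
    intro A hA hAh
    obtain ⟨r, hr, hrA⟩ := hAh.neg.exists_smul_one_sub_posSemidef
    rw [sub_neg_eq_add] at hrA
    have hs : (c / (r + c) : ℝ) ≠ 0 := by positivity
    have hrc : ((r : ℂ) + c) ≠ 0 := by exact_mod_cast (by positivity : r + c ≠ 0)
    have e : ((c / (r + c) : ℝ) : ℂ) • ((r : ℂ) • (1 : Matrix (Idx d x) (Idx d x) ℂ) + A)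
        = ((r / (r + c) : ℝ) : ℂ) • ((c : ℂ) • (1 : Matrix (Idx d x) (Idx d x) ℂ))
          + ((c / (r + c) : ℝ) : ℂ) • A := by
      rw [smul_add, smul_smul, smul_smul]
      congr 2
      push_cast
      ring
    have hone : ((r / (r + c) : ℝ) : ℂ) + ((c / (r + c) : ℝ) : ℂ) = 1 := by
      push_cast
      field_simp
    have h1 : ((c / (r + c) : ℝ) : ℂ) • ((r : ℂ) • (1 : Matrix (Idx d x) (Idx d x) ℂ) + A)
        ∈ aff d x := by
      intro ψ hψ
      rw [e, map_add, map_smul ψ ((r / (r + c) : ℝ) : ℂ),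
        map_smul ψ ((c / (r + c) : ℝ) : ℂ), hc1 ψ hψ, hA ψ hψ, smul_eq_mul, smul_eq_mul, mul_one,
        mul_one, hone]
    have h2 := hφ _ h1 (hrA.smul (by exact_mod_cast (by positivity : 0 ≤ c / (r + c))))
    rw [e, map_add, map_smul φ ((r / (r + c) : ℝ) : ℂ),
      map_smul φ ((c / (r + c) : ℝ) : ℂ), hφc, smul_eq_mul, smul_eq_mul, mul_one, ← hone] at h2
    exact mul_left_cancel₀ (by exact_mod_cast hs) ((add_left_cancel h2).trans (mul_one _).symm)
  have hM' := conjTranspose_mem_aff hM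
  have h1 : φ ((1 / 2 : ℂ) • (M + Mᴴ)) = 1 := by
    refine key _ (fun ψ hψ => ?_) ?_
    · rw [map_smul, map_add, hM ψ hψ, hM' ψ hψ, smul_eq_mul]; norm_num
    · have : star (1 / 2 : ℂ) = 1 / 2 := by simp
      rw [Matrix.IsHermitian, Matrix.conjTranspose_smul, Matrix.conjTranspose_add,
        Matrix.conjTranspose_conjTranspose, add_comm, this]
  -- Every constraint vanishes on `M - Mᴴ`, so adding a multiple of it to `c • 1` stays in the
  -- affine space; the factor `-I / 2` makes the sum Hermitian. The outcome is `φ M = φ Mᴴ`.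
  have h2 : φ ((c : ℂ) • 1 + (-Complex.I / 2) • (M - Mᴴ)) = 1 := by
    refine key _ (fun ψ hψ => ?_) ?_
    · rw [map_add, map_smul ψ (-Complex.I / 2), map_sub, hM ψ hψ, hM' ψ hψ, hc1 ψ hψ]; simp
    · have : star (-Complex.I / 2) = Complex.I / 2 := by simp
      rw [Matrix.IsHermitian, Matrix.conjTranspose_add, Matrix.conjTranspose_smul,
        Matrix.conjTranspose_smul, Matrix.conjTranspose_sub,
        Matrix.conjTranspose_conjTranspose, this, Matrix.conjTranspose_one]
      have : star (c : ℂ) = c := Complex.conj_ofReal c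
      rw [this, neg_div, neg_smul, ← smul_neg, neg_sub]
  rw [map_add, hφc, map_smul, map_sub, smul_eq_mul] at h2
  rw [map_smul, map_add, smul_eq_mul] at h1
  have h3 : φ M - φ Mᴴ = 0 := by
    have h4 : (-Complex.I / 2) * (φ M - φ Mᴴ) = 0 := add_eq_left.mp h2
    exact (mul_eq_zero.1 h4).resolve_left (by simp)
  linear_combination h1 + h3 / 2

/-- Determinism only tests positive inputs, whereas `aff` of an arrow quantifies over the whole
affine space of the source. This bridges the two. -/
theorem choiApply_mem_aff_of_posSemidef (hd : ∀ i, 0 < d i) {x y : HType ι}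
    {M : Matrix (Idx d x × Idx d y) (Idx d x × Idx d y) ℂ}
    (h : ∀ ρ ∈ aff d x, ρ.PosSemidef → choiApply ρ M ∈ aff d y) :
    (M : Matrix (Idx d (arrow x y)) (Idx d (arrow x y)) ℂ) ∈ aff d (arrow x y) :=
  mem_aff_arrow.2 fun _ hρ φ hφ =>
    eq_one_of_forall_posSemidef hd (φ ∘ₗ choiApply.flip M) (fun σ hσ hσ' => h σ hσ hσ' φ hφ) hρ

end HType

/-! ## Characterization of admissible and deterministic maps -/

theorem applyExt_sub_left {a b E F : Type} [Fintype a] (M N : Matrix ((a × b) × E) ((a × b) × E) ℂ)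
    (ρ : Matrix (a × F) (a × F) ℂ) : applyExt (M - N) ρ = applyExt M ρ - applyExt N ρ := by
  ext p q
  simp [applyExt, mul_sub, Finset.sum_sub_distrib]

theorem applyExt_sub_right {a b E F : Type} [Fintype a] (M : Matrix ((a × b) × E) ((a × b) × E) ℂ)
    (ρ σ : Matrix (a × F) (a × F) ℂ) : applyExt M (ρ - σ) = applyExt M ρ - applyExt M σ := by
  ext p q
  simp [applyExt, sub_mul, Finset.sum_sub_distrib]

namespace HType
variable {ι : Type} [DecidableEq ι] {d : ι → ℕ}

/-- The positive operators whose reduction lies in the affine space of `x`. -/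
def IsDet (x : HType ι) {F : Type} [Fintype F]
    (M : Matrix (Idx d x × F) (Idx d x × F) ℂ) : Prop :=
  M.PosSemidef ∧ ptrace M ∈ aff d x

/-- The positive operators dominated by an operator satisfying `IsDet`. -/
def IsAdm (x : HType ι) {F : Type} [Fintype F]
    (M : Matrix (Idx d x × F) (Idx d x × F) ℂ) : Prop :=
  M.PosSemidef ∧ ∃ N, IsDet x N ∧ (N - M).PosSemidef

theorem trace_ptrace {a F : Type} [Fintype a] [Fintype F] (M : Matrix (a × F) (a × F) ℂ) :
    (ptrace M).trace = M.trace := by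
  simp [ptrace, Matrix.trace, Fintype.sum_prod_type]

theorem IsDet.applyExt {x y : HType ι} {E F : Type} [Fintype E] [Fintype F]
    {M : Matrix ((Idx d x × Idx d y) × E) ((Idx d x × Idx d y) × E) ℂ}
    (hM : IsDet (x.arrow y) M) {ρ : Matrix (Idx d x × F) (Idx d x × F) ℂ} (hρ : IsDet x ρ) :
    IsDet y (applyExt M ρ) := by
  refine ⟨applyExt_posSemidef hM.1 hρ.1, ?_⟩
  rw [ptrace_applyExt]
  exact mem_aff_arrow.1 hM.2 _ hρ.2

theorem IsAdm.applyExt {x y : HType ι} {E F : Type} [Fintype E] [Fintype F]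
    {M : Matrix ((Idx d x × Idx d y) × E) ((Idx d x × Idx d y) × E) ℂ}
    (hM : IsAdm (x.arrow y) M) {ρ : Matrix (Idx d x × F) (Idx d x × F) ℂ} (hρ : IsAdm x ρ) :
    IsAdm y (applyExt M ρ) := by
  obtain ⟨hM, (N : Matrix ((Idx d x × Idx d y) × E) ((Idx d x × Idx d y) × E) ℂ), hN, hNM⟩ := hM
  obtain ⟨hρ, σ, hσ, hσρ⟩ := hρ
  refine ⟨applyExt_posSemidef hM hρ, _, hN.applyExt hσ, ?_⟩
  -- Both summands on the right are positive maps applied to positive operators.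
  have e : _root_.applyExt N σ - _root_.applyExt M ρ
      = _root_.applyExt (N - M) σ + _root_.applyExt M (σ - ρ) := by
    rw [applyExt_sub_right, applyExt_sub_left]; abel
  exact e ▸ (applyExt_posSemidef hNM hσ.1).add (applyExt_posSemidef hM hσρ)

/-- The unnormalized maximally entangled operator. -/
def entangled (a : Type) [DecidableEq a] : Matrix (a × a) (a × a) ℂ :=
  fun p q => if p.1 = p.2 ∧ q.1 = q.2 then 1 else 0

theorem entangled_posSemidef (a : Type) [Fintype a] [DecidableEq a] :
    (entangled a).PosSemidef := by
  have h : entangled a = Matrix.vecMulVec (fun p => if p.1 = p.2 then 1 else 0)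
      (star fun p => if p.1 = p.2 then 1 else 0) := by
    ext p q
    by_cases h1 : p.1 = p.2 <;> by_cases h2 : q.1 = q.2 <;>
      simp [entangled, Matrix.vecMulVec_apply, h1, h2]
  rw [h]
  exact Matrix.posSemidef_vecMulVec_self_star _

theorem applyExt_smul_entangled {a b E : Type} [Fintype a] [DecidableEq a]
    (M : Matrix ((a × b) × E) ((a × b) × E) ℂ) (c : ℂ) (p q) :
    _root_.applyExt M (c • entangled a) p q = c * M ((p.2.2, p.1), p.2.1) ((q.2.2, q.1), q.2.1) := by
  simp [_root_.applyExt, entangled, ite_and]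

/-- The entangled operator is dominated by a multiple of the identity of `H_x ⊗ H_x`, and a suitable
multiple of that identity is deterministic. So the input that reveals a Choi operator is admissible
after rescaling. -/
theorem exists_isAdm_smul_entangled (hd : ∀ i, 0 < d i) (x : HType ι) :
    ∃ c : ℝ, 0 < c ∧ IsAdm x ((c : ℂ) • entangled (Idx d x)) := by
  have := nonempty_idx hd x
  obtain ⟨c, hc, hc1, -⟩ := exists_smul_one_mem_aff hd x
  obtain ⟨r, hr, hrP⟩ :=
    (entangled_posSemidef (Idx d x)).isHermitian.exists_smul_one_sub_posSemidef
  set n : ℝ := ((Fintype.card (Idx d x) : ℕ) : ℝ) with hn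
  have hn0 : 0 < n := by rw [hn]; exact_mod_cast Fintype.card_pos
  have hpos : (0 : ℂ) ≤ ((c / (n * r) : ℝ) : ℂ) := by
    exact_mod_cast (by positivity : 0 ≤ c / (n * r))
  refine ⟨c / (n * r), by positivity, (entangled_posSemidef _).smul hpos,
    ((c / n : ℝ) : ℂ) • 1, ⟨Matrix.PosSemidef.one.smul ?_, ?_⟩, ?_⟩
  · exact_mod_cast (by positivity : 0 ≤ c / n)
  · convert hc1 using 1
    ext s t
    by_cases h : s = t
    · subst h
      have : (n : ℂ) ≠ 0 := by exact_mod_cast hn0.ne'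
      simp [ptrace]
      rw [show (Fintype.card (Idx d x) : ℂ) = n by simp [hn]]
      field_simp
    · simp [ptrace, h]
  · have := hrP.smul hpos
    rw [smul_sub, smul_smul] at this
    convert this using 3
    rw [← Complex.ofReal_mul]
    congr 1
    field_simp

theorem mem_det_and_mem_adm (hd : ∀ i, 0 < d i) : ∀ (x : HType ι) (F : Type) [Fintype F]
    [Nonempty F] (M : Matrix (Idx d x × F) (Idx d x × F) ℂ),
    (M ∈ Det d x F ↔ IsDet x M) ∧ (M ∈ Adm d x F ↔ IsAdm x M)
  | elem S, F, _, _, M => by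
    have key : ∀ M : Matrix (Idx d (elem S) × F) (Idx d (elem S) × F) ℂ,
        IsState M ↔ IsDet (elem S) M := fun M => by
      rw [IsDet, mem_aff_elem, trace_ptrace]; rfl
    refine ⟨?_, ?_⟩
    · rw [← key]; simp [Det]
    · simp only [IsAdm, ← key]; simp [Adm]
  | arrow x y, E, _, _, M => by
    have ihx := mem_det_and_mem_adm hd x
    have ihy := mem_det_and_mem_adm hd y
    -- The output on the entangled input is positive and is, up to scale and reindexing, `M` itself.
    have hpos : ∀ M : Matrix ((Idx d x × Idx d y) × E) ((Idx d x × Idx d y) × E) ℂ,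
        CompletelyMaps (Adm d x) (Adm d y) M → M.PosSemidef := by
      intro M hM
      have := nonempty_idx hd x
      obtain ⟨c, hc, h⟩ := exists_isAdm_smul_entangled hd x
      have h1 := ((ihy _ _).2.1 (hM _ _ ((ihx _ _).2.2 h))).1
      have h2 := (h1.submatrix (fun p : (Idx d x × Idx d y) × E => (p.1.2, (p.2, p.1.1)))).smul
        (a := ((c⁻¹ : ℝ) : ℂ)) (by exact_mod_cast (by positivity : 0 ≤ c⁻¹))
      convert h2 using 1
      ext p q
      have hc0 : (c : ℂ) ≠ 0 := by exact_mod_cast hc.ne'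
      simp only [Matrix.smul_apply, Matrix.submatrix_apply, applyExt_smul_entangled]
      simp [hc0]
    have hdet : ∀ M : Matrix ((Idx d x × Idx d y) × E) ((Idx d x × Idx d y) × E) ℂ,
        M.PosSemidef → (CompletelyMaps (Det d x) (Det d y) M ↔ IsDet (x.arrow y) M) := by
      intro M hM
      refine ⟨fun h => ⟨hM, ?_⟩, fun h F _ _ ρ hρ =>
        (ihy _ _).1.2 (h.applyExt ((ihx _ _).1.1 hρ))⟩
      refine choiApply_mem_aff_of_posSemidef hd fun ρ hρ hρ' => ?_
      have h1 : ptrace (ρ.submatrix Prod.fst Prod.fst : Matrix (Idx d x × Unit) _ ℂ) = ρ := by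
        ext s t; simp [ptrace]
      have h2 := ((ihy _ _).1.1 (h Unit _ ((ihx Unit _).1.2
        ⟨hρ'.submatrix Prod.fst, by rw [h1]; exact hρ⟩))).2
      rwa [ptrace_applyExt, h1] at h2
    have hadm : ∀ M : Matrix ((Idx d x × Idx d y) × E) ((Idx d x × Idx d y) × E) ℂ,
        AdmArrow (Adm d x) (Det d x) (Adm d y) (Det d y) M ↔ IsAdm (x.arrow y) M := by
      intro M
      constructor
      · rintro ⟨h, n, N, hN, hMN⟩
        have h1 : (∑ i, N i).PosSemidef := Matrix.posSemidef_sum _ fun i _ => hpos _ (hN i)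
        refine ⟨hpos _ h, M + ∑ i, N i, (hdet _ ((hpos _ h).add h1)).1 hMN, ?_⟩
        have e : (M + ∑ i, N i - M).PosSemidef := by rwa [add_sub_cancel_left]
        exact e
      · intro h
        have hA : ∀ M : Matrix ((Idx d x × Idx d y) × E) ((Idx d x × Idx d y) × E) ℂ,
            IsAdm (x.arrow y) M → CompletelyMaps (Adm d x) (Adm d y) M := fun M h F _ _ ρ hρ =>
          (ihy _ _).2.2 (h.applyExt ((ihx _ _).2.1 hρ))
        obtain ⟨hM, (N : Matrix ((Idx d x × Idx d y) × E) ((Idx d x × Idx d y) × E) ℂ), hN, hNM⟩ := id h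
        -- A single completing map suffices: the difference from the dominating deterministic
        -- operator.
        refine ⟨hA _ h, 1, fun _ => N - M, fun _ => hA _ ⟨hNM, N, hN, ?_⟩, ?_⟩
        · have e : (N - (N - M)).PosSemidef := by rwa [sub_sub_cancel]
          exact e
        · have e : M + ∑ _i : Fin 1, (N - M) = N := by simp
          rw [e]
          exact (hdet _ hN.1).2 hN
    refine ⟨?_, ?_⟩
    · have e : M ∈ Det d (x.arrow y) E ↔ AdmArrow (Adm d x) (Det d x) (Adm d y) (Det d y) M ∧
          CompletelyMaps (Det d x) (Det d y) M := by simp only [Det]; rfl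
      refine e.trans ⟨fun h => (hdet _ ((hadm M).1 h.1).1).1 h.2,
        fun h => ⟨(hadm M).2 ⟨h.1, M, h, ?_⟩, (hdet _ h.1).2 h⟩⟩
      rw [sub_self]
      exact Matrix.PosSemidef.zero
    · have e : M ∈ Adm d (x.arrow y) E ↔ AdmArrow (Adm d x) (Det d x) (Adm d y) (Det d y) M := by
        simp only [Adm]; rfl
      exact e.trans (hadm M)

end HType

/-! ## Labelled operators as kernels on total configurations -/

/-- A choice of a basis vector for every system. -/
abbrev TotalCfg {ι : Type} (d : ι → ℕ) : Type := (i : ι) → Fin (d i)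

section
variable {ι : Type} {d : ι → ℕ}

/-- Some total configuration which extends `c`. -/
def Cfg.extend [DecidableEq ι] (hd : ∀ i, 0 < d i) {S : Finset ι} (c : Cfg d S) : TotalCfg d :=
  fun i => if h : i ∈ S then c ⟨i, h⟩ else ⟨0, hd i⟩

theorem Cfg.extend_apply [DecidableEq ι] (hd : ∀ i, 0 < d i) {S : Finset ι} (c : Cfg d S) (i : S) :
    c.extend hd i = c i := by
  simp [Cfg.extend]

/-- The configuration equal to `h` on `H` and to `c` elsewhere. -/
def TotalCfg.overwrite [DecidableEq ι] {H : Finset ι} (c : TotalCfg d) (h : Cfg d H) : TotalCfg d :=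
  fun i => if hi : i ∈ H then h ⟨i, hi⟩ else c i

theorem TotalCfg.overwrite_of_mem [DecidableEq ι] {H : Finset ι} (c : TotalCfg d) (h : Cfg d H) {i : ι}
    (hi : i ∈ H) : c.overwrite h i = h ⟨i, hi⟩ := dif_pos hi

theorem TotalCfg.overwrite_of_notMem [DecidableEq ι] {H : Finset ι} (c : TotalCfg d) (h : Cfg d H) {i : ι}
    (hi : i ∉ H) : c.overwrite h i = c i := dif_neg hi

namespace LabelledOp

/-- The matrix entries of a labelled operator, as a function of total configurations. -/
def ev (R : LabelledOp d) (c c' : TotalCfg d) : ℂ := R.op (fun i => c i) (fun i => c' i)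

theorem ev_congr (R : LabelledOp d) {c₁ c₂ c₁' c₂' : TotalCfg d} (h : ∀ i ∈ R.supp, c₁ i = c₂ i)
    (h' : ∀ i ∈ R.supp, c₁' i = c₂' i) : R.ev c₁ c₁' = R.ev c₂ c₂' := by
  unfold ev
  congr 1
  · exact funext fun i => h i i.2
  · exact funext fun i => h' i i.2

theorem ext_ev [DecidableEq ι] (hd : ∀ i, 0 < d i) {R S : LabelledOp d} (h : R.supp = S.supp)
    (he : ∀ c c', R.ev c c' = S.ev c c') : R = S := by
  obtain ⟨U, R⟩ := R
  obtain ⟨V, S⟩ := S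
  obtain rfl : U = V := h
  congr 1
  ext c c'
  have := he (c.extend hd) (c'.extend hd)
  simpa only [ev, Cfg.extend_apply] using this

end LabelledOp

namespace HType
variable [DecidableEq ι]

/-- The basis label of `H_x` given by a total configuration. -/
def readTotal : (x : HType ι) → TotalCfg d → Idx d x
  | elem _, c => fun i => c i
  | arrow x y, c => (readTotal x c, readTotal y c)

theorem read_eq_readTotal : ∀ (x : HType ι) (c : TotalCfg d),
    x.read d (fun i => c i) = x.readTotal c
  | elem _, _ => rfl
  | arrow x y, c => Prod.ext (read_eq_readTotal x c) (read_eq_readTotal y c)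

theorem readTotal_congr : ∀ (x : HType ι) {c c' : TotalCfg d}, (∀ i ∈ x.ele, c i = c' i) →
    x.readTotal c = x.readTotal c'
  | elem _, _, _, h => funext fun i => h i i.2
  | arrow x y, _, _, h => Prod.ext
      (readTotal_congr x fun i hi => h i (Finset.mem_union_left _ hi))
      (readTotal_congr y fun i hi => h i (Finset.mem_union_right _ hi))

theorem eq_of_readTotal_eq : ∀ (x : HType ι) {c c' : TotalCfg d}, x.readTotal c = x.readTotal c' →
    ∀ i ∈ x.ele, c i = c' i
  | elem _, _, _, h, i, hi => congrFun h ⟨i, hi⟩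
  | arrow x y, _, _, h, i, hi => (Finset.mem_union.1 hi).elim
      (eq_of_readTotal_eq x (Prod.ext_iff.1 h).1 i) (eq_of_readTotal_eq y (Prod.ext_iff.1 h).2 i)

/-- Distinctness of labels ensures that the values prescribed by the two sides of an arrow never
conflict. -/
theorem exists_readTotal_eq (hd : ∀ i, 0 < d i) : ∀ (x : HType ι), x.LabelsDistinct →
    ∀ p : Idx d x, ∃ c : TotalCfg d, x.readTotal c = p
  | elem S, _, p => ⟨Cfg.extend (S := S) hd p, funext fun i => Cfg.extend_apply (S := S) hd p i⟩
  | arrow x y, h, p => by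
    obtain ⟨c, hc⟩ := exists_readTotal_eq hd x h.1 p.1
    obtain ⟨c', hc'⟩ := exists_readTotal_eq hd y h.2.1 p.2
    refine ⟨fun i => if i ∈ x.ele then c i else c' i, Prod.ext ?_ ?_⟩
    · rw [← hc]
      exact readTotal_congr x fun i hi => if_pos hi
    · rw [← hc']
      exact readTotal_congr y fun i hi => if_neg (Finset.disjoint_right.1 h.2.2 hi)

end HType

variable [DecidableEq ι]

/-- From here on determinism enters only in this form: positivity plus linear constraints, with the
trivial extension system `Unit` removed. -/
theorem mem_T1_iff (hd : ∀ i, 0 < d i) {z : HType ι} {R : LabelledOp d} :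
    R ∈ T1 d z ↔ R.supp = z.ele ∧ ∃ M : Matrix (HType.Idx d z) (HType.Idx d z) ℂ,
      M.PosSemidef ∧ M ∈ HType.aff d z ∧
        ∀ c c', R.ev c c' = M (z.readTotal c) (z.readTotal c') := by
  constructor
  · rintro ⟨M, hM, rfl⟩
    obtain ⟨h1, h2⟩ := ((HType.mem_det_and_mem_adm hd z Unit M).1).1 hM
    refine ⟨rfl, ptrace M, ?_, h2, fun c c' => ?_⟩
    · have e : ptrace M = M.submatrix (fun p => (p, ())) (fun p => (p, ())) := by
        ext; simp [ptrace]
      exact e ▸ h1.submatrix _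
    · simp [ptrace, LabelledOp.ev, HType.read_eq_readTotal]
  · rintro ⟨h, M, h1, h2, h3⟩
    have e : ptrace (M.submatrix Prod.fst Prod.fst : Matrix (HType.Idx d z × Unit) _ ℂ) = M := by
      ext; simp [ptrace]
    refine ⟨M.submatrix Prod.fst Prod.fst, ((HType.mem_det_and_mem_adm hd z Unit _).1).2
      ⟨h1.submatrix _, by rwa [e]⟩, ?_⟩
    refine LabelledOp.ext_ev hd h fun c c' => ?_
    rw [h3]
    simp [LabelledOp.ev, HType.read_eq_readTotal]

/-- The labelled operator with a given matrix on `H_x`. -/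
def HType.label (x : HType ι) (M : Matrix (HType.Idx d x) (HType.Idx d x) ℂ) : LabelledOp d :=
  ⟨x.ele, M.submatrix (x.read d) (x.read d)⟩

theorem HType.label_ev (x : HType ι) (M : Matrix (HType.Idx d x) (HType.Idx d x) ℂ)
    (c c' : TotalCfg d) : (x.label M).ev c c' = M (x.readTotal c) (x.readTotal c') := by
  simp [LabelledOp.ev, HType.label, HType.read_eq_readTotal]

theorem HType.label_mem_T1 (hd : ∀ i, 0 < d i) {x : HType ι}
    {M : Matrix (HType.Idx d x) (HType.Idx d x) ℂ} (h : M.PosSemidef) (h' : M ∈ HType.aff d x) :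
    x.label M ∈ T1 d x :=
  (mem_T1_iff hd).2 ⟨rfl, M, h, h', x.label_ev M⟩

/-! ## The link product and contractions on total configurations -/

/-- The partial transpose pairs row indices with row indices and column indices with column indices,
so `R` and `S` are evaluated at the same two configurations. -/
theorem link_ev (R S : LabelledOp d) (c c' : TotalCfg d) :
    (link R S).ev c c' = ∑ h : Cfg d (R.supp ∩ S.supp), ∑ h' : Cfg d (R.supp ∩ S.supp),
      R.ev (c.overwrite h) (c'.overwrite h') * S.ev (c.overwrite h) (c'.overwrite h') := by
  change ∑ h : Cfg d (R.supp ∩ S.supp),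
    (pad (U := R.supp ∪ S.supp) Finset.subset_union_left R.op *
      pad (U := R.supp ∪ S.supp) Finset.subset_union_right
        (partialTranspose (R.supp ∩ S.supp) S.op))
      (fun i => c.overwrite h i) (fun i => c'.overwrite h i) = _
  refine Finset.sum_congr rfl fun h _ => ?_
  rw [Matrix.mul_apply]
  symm
  -- The padding identities force the middle index of the matrix product to be the row index on
  -- systems of `S` alone and the column index on systems of `R` alone. Only its values on the
  -- shared systems are free.
  let k : Cfg d (R.supp ∩ S.supp) → TotalCfg d :=
    TotalCfg.overwrite fun i => if i ∈ S.supp then c i else c' i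
  refine Fintype.sum_of_injective (fun h' (i : (R.supp ∪ S.supp : Finset ι)) => k h' i) ?_ _ _ ?_ ?_
  · intro h₁ h₂ he
    funext i
    have := congrFun he ⟨i, Finset.mem_union_left _ (Finset.mem_inter.1 i.2).1⟩
    simpa only [k, TotalCfg.overwrite_of_mem _ _ i.2] using this
  · intro m hm
    by_contra hne
    simp only [pad, mul_eq_zero, not_or, ite_eq_right_iff, not_forall] at hne
    obtain ⟨⟨h1, -⟩, h2, -⟩ := hne
    refine hm ⟨fun i => m ⟨i, Finset.mem_union_left _ (Finset.mem_inter.1 i.2).1⟩, ?_⟩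
    funext i
    by_cases hi : (i : ι) ∈ R.supp ∩ S.supp
    · exact TotalCfg.overwrite_of_mem _ _ hi
    · refine (TotalCfg.overwrite_of_notMem _ _ hi).trans ?_
      by_cases hS : (i : ι) ∈ S.supp
      · rw [if_pos hS]
        have := h1 i fun hR => hi (Finset.mem_inter.2 ⟨hR, hS⟩)
        rw [← this, TotalCfg.overwrite_of_notMem _ _ hi]
      · rw [if_neg hS]
        have := h2 i hS
        rw [this, TotalCfg.overwrite_of_notMem _ _ hi]
  · intro h'
    simp only [pad]
    rw [if_pos, if_pos]
    · congr 1
      · refine congrArg₂ R.op rfl (funext fun i => ?_)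
        change c'.overwrite h' i = k h' i
        by_cases hi : (i : ι) ∈ R.supp ∩ S.supp
        · rw [TotalCfg.overwrite_of_mem _ _ hi]; exact (TotalCfg.overwrite_of_mem _ _ hi).symm
        · have hS : (i : ι) ∉ S.supp := fun hS => hi (Finset.mem_inter.2 ⟨i.2, hS⟩)
          rw [TotalCfg.overwrite_of_notMem _ _ hi]
          exact ((TotalCfg.overwrite_of_notMem _ _ hi).trans (if_neg hS)).symm
      · refine congrArg₂ S.op (funext fun i => ?_) (funext fun i => ?_)
        · by_cases hi : (i : ι) ∈ R.supp ∩ S.supp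
          · refine Eq.symm ((if_pos hi).trans ?_)
            change c'.overwrite h i = c.overwrite h i
            rw [TotalCfg.overwrite_of_mem _ _ hi, TotalCfg.overwrite_of_mem _ _ hi]
          · refine Eq.symm ((if_neg hi).trans ?_)
            change k h' i = c.overwrite h i
            rw [TotalCfg.overwrite_of_notMem _ _ hi]
            exact (TotalCfg.overwrite_of_notMem _ _ hi).trans (if_pos i.2)
        · by_cases hi : (i : ι) ∈ R.supp ∩ S.supp
          · refine Eq.symm ((if_pos hi).trans ?_)
            change k h' i = c'.overwrite h' i
            rw [TotalCfg.overwrite_of_mem _ _ hi]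
            exact TotalCfg.overwrite_of_mem _ _ hi
          · refine Eq.symm ((if_neg hi).trans ?_)
            change c'.overwrite h i = c'.overwrite h' i
            rw [TotalCfg.overwrite_of_notMem _ _ hi, TotalCfg.overwrite_of_notMem _ _ hi]
    · intro i hS
      have hi : (i : ι) ∉ R.supp ∩ S.supp := fun h => hS (Finset.mem_inter.1 h).2
      rw [TotalCfg.overwrite_of_notMem _ _ hi]
      exact (TotalCfg.overwrite_of_notMem _ _ hi).trans (if_neg hS)
    · intro i hR
      have hi : (i : ι) ∉ R.supp ∩ S.supp := fun h => hR (Finset.mem_inter.1 h).1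
      rw [TotalCfg.overwrite_of_notMem _ _ hi]
      refine Eq.symm ((TotalCfg.overwrite_of_notMem _ _ hi).trans (if_pos ?_))
      exact (Finset.mem_union.1 i.2).resolve_left hR

/-- Overwriting both copies of the systems in `H`. -/
def TotalCfg.overwriteBoth {H : Finset ι} (c : TotalCfg (Sum.elim d d)) (h : Cfg d H) :
    TotalCfg (Sum.elim d d)
  | .inl a => TotalCfg.overwrite (d := d) (fun b => c (.inl b)) h a
  | .inr a => TotalCfg.overwrite (d := d) (fun b => c (.inr b)) h a

theorem TotalCfg.overwriteBoth_of_notMem {H : Finset ι} (c : TotalCfg (Sum.elim d d)) (h : Cfg d H) :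
    ∀ {k : ι ⊕ ι}, k.elim id id ∉ H → c.overwriteBoth h k = c k
  | .inl a, hk => TotalCfg.overwrite_of_notMem (d := d) (i := a) (fun b => c (.inl b)) h hk
  | .inr a, hk => TotalCfg.overwrite_of_notMem (d := d) (i := a) (fun b => c (.inr b)) h hk

theorem TotalCfg.overwriteBoth_inl_of_mem {H : Finset ι} (c : TotalCfg (Sum.elim d d))
    (h : Cfg d H) {a : ι} (ha : a ∈ H) : c.overwriteBoth h (.inl a) = h ⟨a, ha⟩ :=
  TotalCfg.overwrite_of_mem (d := d) (fun b => c (.inl b)) h ha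

theorem TotalCfg.overwriteBoth_inr_of_mem {H : Finset ι} (c : TotalCfg (Sum.elim d d))
    (h : Cfg d H) {a : ι} (ha : a ∈ H) : c.overwriteBoth h (.inr a) = h ⟨a, ha⟩ :=
  TotalCfg.overwrite_of_mem (d := d) (fun b => c (.inr b)) h ha

/-- `Phi` vanishes unless the two copies of `a` agree, separately in the row and in the column. Each
sum over pairs of values thus collapses to its diagonal. -/
theorem contract_ev (a : ι) (R : LabelledOp (Sum.elim d d)) (hl : .inl a ∈ R.supp)
    (hr : .inr a ∈ R.supp) (c c' : TotalCfg (Sum.elim d d)) :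
    (contract (.inl a) (.inr a) R).ev c c' = ∑ h : Cfg d {a}, ∑ h' : Cfg d {a},
      R.ev (c.overwriteBoth h) (c'.overwriteBoth h') := by
  have ha : a ∈ ({a} : Finset ι) := Finset.mem_singleton_self a
  have hl' : .inl a ∈ R.supp ∩ (Phi (d := Sum.elim d d) (.inl a) (.inr a)).supp := by
    simp [Phi, hl]
  have hr' : .inr a ∈ R.supp ∩ (Phi (d := Sum.elim d d) (.inl a) (.inr a)).supp := by
    simp [Phi, hr]
  have hmem : ∀ {k}, k ∈ R.supp ∩ (Phi (d := Sum.elim d d) (.inl a) (.inr a)).supp →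
      k = .inl a ∨ k = .inr a := by
    intro k hk
    simpa [Phi] using (Finset.mem_inter.1 hk).2
  have hPhi : ∀ c c' : TotalCfg (Sum.elim d d), (Phi (.inl a) (.inr a)).ev c c' =
      if (c (.inl a) : ℕ) = c (.inr a) ∧ (c' (.inl a) : ℕ) = c' (.inr a) then 1 else 0 :=
    fun _ _ => rfl
  let e : Cfg d {a} →
      Cfg (Sum.elim d d) (R.supp ∩ (Phi (d := Sum.elim d d) (.inl a) (.inr a)).supp) :=
    fun h k => c.overwriteBoth h k
  have hinj : Function.Injective e := by
    intro h₁ h₂ he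
    funext ⟨i, hi⟩
    obtain rfl := Finset.mem_singleton.1 hi
    have := congrFun he ⟨.inl i, hl'⟩
    exact (c.overwriteBoth_inl_of_mem h₁ hi).symm.trans
      (this.trans (c.overwriteBoth_inl_of_mem h₂ hi))
  have hov : ∀ (c : TotalCfg (Sum.elim d d)) h, c.overwrite (e h) = c.overwriteBoth h := by
    intro c₀ h
    funext k
    by_cases hk : k ∈ R.supp ∩ (Phi (d := Sum.elim d d) (.inl a) (.inr a)).supp
    · rw [TotalCfg.overwrite_of_mem _ _ hk]
      obtain rfl | rfl := hmem hk
      · exact (c.overwriteBoth_inl_of_mem h ha).trans (c₀.overwriteBoth_inl_of_mem h ha).symm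
      · exact (c.overwriteBoth_inr_of_mem h ha).trans (c₀.overwriteBoth_inr_of_mem h ha).symm
    · rw [TotalCfg.overwrite_of_notMem _ _ hk, TotalCfg.overwriteBoth_of_notMem]
      intro hka
      rw [Finset.mem_singleton] at hka
      rcases k with k | k
      · exact hk ((show k = a from hka) ▸ hl')
      · exact hk ((show k = a from hka) ▸ hr')
  have hlr : ∀ (c : TotalCfg (Sum.elim d d)) (h : Cfg d {a}),
      (c.overwriteBoth h (.inl a) : ℕ) = c.overwriteBoth h (.inr a) := fun c h => by
    have h1 : c.overwriteBoth h (.inl a) = h ⟨a, ha⟩ :=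
      c.overwriteBoth_inl_of_mem h ha
    have h2 : c.overwriteBoth h (.inr a) = h ⟨a, ha⟩ :=
      c.overwriteBoth_inr_of_mem h ha
    rw [h1, h2]
  have hrange : ∀ g, g ∉ Set.range e → ∀ c : TotalCfg (Sum.elim d d),
      (c.overwrite g (.inl a) : ℕ) ≠ c.overwrite g (.inr a) := by
    intro g hg c₀ heq
    rw [TotalCfg.overwrite_of_mem _ _ hl', TotalCfg.overwrite_of_mem _ _ hr'] at heq
    have heq' : (g ⟨.inl a, hl'⟩ : Fin (d a)) = g ⟨.inr a, hr'⟩ := Fin.ext heq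
    let h₀ : Cfg d {a} := fun i => Fin.cast (congrArg d (Finset.mem_singleton.1 i.2).symm)
      (g ⟨.inl a, hl'⟩ : Fin (d a))
    refine hg ⟨h₀, ?_⟩
    funext ⟨k, hk⟩
    obtain rfl | rfl := hmem hk
    · exact c.overwriteBoth_inl_of_mem h₀ ha
    · exact (c.overwriteBoth_inr_of_mem h₀ ha).trans heq'
  rw [contract, link_ev]
  symm
  refine Fintype.sum_of_injective e hinj _ _ ?_ fun h => ?_
  · intro g hg
    refine Finset.sum_eq_zero fun g' _ => ?_
    rw [hPhi, if_neg fun hh => hrange g hg _ hh.1, mul_zero]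
  · refine Fintype.sum_of_injective e hinj _ _ ?_ fun h' => ?_
    · intro g hg
      rw [hPhi, if_neg fun hh => hrange g hg _ hh.2, mul_zero]
    · rw [hPhi, hov, hov, if_pos ⟨hlr _ _, hlr _ _⟩, mul_one]

theorem sum_overwriteBoth_insert {H : Finset ι} {a : ι} (ha : a ∉ H)
    (f : TotalCfg (Sum.elim d d) → ℂ) (c : TotalCfg (Sum.elim d d)) :
    ∑ h : Cfg d (insert a H), f (c.overwriteBoth h) =
      ∑ h : Cfg d {a}, ∑ k : Cfg d H, f ((c.overwriteBoth h).overwriteBoth k) := by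
  rw [← Fintype.sum_prod_type']
  symm
  let e : Cfg d {a} × Cfg d H → Cfg d (insert a H) := fun p i =>
    if hi : (i : ι) ∈ H then p.2 ⟨i, hi⟩
    else p.1 ⟨i, Finset.mem_singleton.2 ((Finset.mem_insert.1 i.2).resolve_right hi)⟩
  refine Fintype.sum_bijective e ⟨?_, ?_⟩ _ _ ?_
  · rintro ⟨h₁, k₁⟩ ⟨h₂, k₂⟩ he
    refine Prod.ext (funext fun ⟨i, hi⟩ => ?_) (funext fun ⟨i, hi⟩ => ?_)
    · obtain rfl := Finset.mem_singleton.1 hi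
      simpa [e, ha] using congrFun he ⟨i, Finset.mem_insert_self _ _⟩
    · simpa [e, hi] using congrFun he ⟨i, Finset.mem_insert_of_mem hi⟩
  · intro g
    refine ⟨(fun i => g ⟨i, by rw [Finset.mem_singleton.1 i.2]; exact Finset.mem_insert_self _ _⟩,
      fun i => g ⟨i, Finset.mem_insert_of_mem i.2⟩), funext fun i => ?_⟩
    simp only [e]
    split_ifs <;> rfl
  · rintro ⟨h, k⟩
    congr 1
    have key : ∀ c : TotalCfg d, (c.overwrite h).overwrite k = c.overwrite (e (h, k)) := by
      intro c
      funext i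
      by_cases hi : i ∈ H
      · rw [TotalCfg.overwrite_of_mem _ _ hi, TotalCfg.overwrite_of_mem _ _ (Finset.mem_insert_of_mem hi)]
        simp [e, hi]
      · rw [TotalCfg.overwrite_of_notMem _ _ hi]
        by_cases hia : i = a
        · subst hia
          rw [TotalCfg.overwrite_of_mem _ _ (Finset.mem_singleton_self i),
            TotalCfg.overwrite_of_mem _ _ (Finset.mem_insert_self i H)]
          simp [e, hi]
        · rw [TotalCfg.overwrite_of_notMem _ _ (by simpa using hia),
            TotalCfg.overwrite_of_notMem _ _ (by simp [hia, hi])]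
    funext i
    rcases i with i | i
    · exact congrFun (key fun b => c (.inl b)) i
    · exact congrFun (key fun b => c (.inr b)) i

/-- The resulting kernel involves the list only through its set of labels, so the order of the
contractions is immaterial. -/
theorem contractAll_supp_and_ev (R : LabelledOp (Sum.elim d d)) : ∀ l : List ι, l.Nodup →
    (∀ a ∈ l, .inl a ∈ R.supp ∧ .inr a ∈ R.supp) →
    (∀ k : ι ⊕ ι, k ∈ (contractAll (l.map fun a => (.inl a, .inr a)) R).supp ↔
      k ∈ R.supp ∧ k.elim id id ∉ l) ∧
    ∀ c c', (contractAll (l.map fun a => (.inl a, .inr a)) R).ev c c' =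
      ∑ h : Cfg d l.toFinset, ∑ h' : Cfg d l.toFinset,
        R.ev (c.overwriteBoth h) (c'.overwriteBoth h')
  | [], _, _ => by
    refine ⟨fun k => by simp [contractAll], fun c c' => ?_⟩
    have hov : ∀ (c : TotalCfg (Sum.elim d d)) (h : Cfg d ([] : List ι).toFinset),
        c.overwriteBoth h = c :=
      fun c h => funext fun k => TotalCfg.overwriteBoth_of_notMem c h (by simp)
    have : IsEmpty (([] : List ι).toFinset) :=
      ⟨fun i => by simpa using i.2⟩
    have : Unique (Cfg d ([] : List ι).toFinset) := Pi.uniqueOfIsEmpty _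
    rw [Fintype.sum_unique, Fintype.sum_unique, hov, hov]
    rfl
  | a :: l, hn, hl => by
    obtain ⟨han, hn⟩ := List.nodup_cons.1 hn
    obtain ⟨ih1, ih2⟩ := contractAll_supp_and_ev R l hn fun b hb =>
      hl b (List.mem_cons_of_mem _ hb)
    obtain ⟨h1, h2⟩ := hl a List.mem_cons_self
    set T := contractAll (l.map fun a => (.inl a, .inr a)) R with hT
    have e : contractAll ((a :: l).map fun a => (.inl a, .inr a)) R
        = contract (.inl a) (.inr a) T := rfl
    rw [e]
    have hTl : .inl a ∈ T.supp := (ih1 _).2 ⟨h1, han⟩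
    have hTr : .inr a ∈ T.supp := (ih1 _).2 ⟨h2, han⟩
    refine ⟨fun k => ?_, fun c c' => ?_⟩
    · have : (contract (.inl a) (.inr a) T).supp = (T.supp ∪ {.inl a, .inr a}) \
        (T.supp ∩ {.inl a, .inr a}) := rfl
      rw [this]
      have hk : k.elim id id = a ↔ k = .inl a ∨ k = .inr a := by
        rcases k with k | k <;> simp
      simp only [Finset.mem_sdiff, Finset.mem_union, Finset.mem_inter, Finset.mem_insert,
        Finset.mem_singleton, List.mem_cons, not_or, ih1, hk]
      have : k = .inl a ∨ k = .inr a → k ∈ R.supp := by rintro (rfl | rfl) <;> assumption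
      have : k = .inl a ∨ k = .inr a → k.elim id id ∉ l := by rintro (rfl | rfl) <;> exact han
      tauto
    · have hal : a ∉ l.toFinset := by simpa using han
      rw [contract_ev a T hTl hTr]
      simp only [ih2]
      rw [List.toFinset_cons, sum_overwriteBoth_insert hal
        (fun t => ∑ h' : Cfg d (insert a l.toFinset), R.ev t (c'.overwriteBoth h'))]
      refine Finset.sum_congr rfl fun h _ => ?_
      rw [Finset.sum_comm]
      refine Finset.sum_congr rfl fun k _ => ?_
      rw [sum_overwriteBoth_insert hal
        (fun t => R.ev ((c.overwriteBoth h).overwriteBoth k) t)]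

end

/-! ## Relabelling -/

namespace HType
section
variable {ι κ : Type} (g : ι ↪ κ)

theorem exists_relabel_eq [DecidableEq κ] : ∀ z : HType κ, (∀ k ∈ z.ele, k ∈ Set.range g) →
    ∃ z₀ : HType ι, z₀.relabel g = z
  | elem S, h => ⟨elem (S.preimage g g.injective.injOn), by
      rw [relabel]
      congr 1
      ext k
      simp only [Finset.mem_map, Finset.mem_preimage]
      refine ⟨by rintro ⟨i, hi, rfl⟩; exact hi, fun hk => ?_⟩
      obtain ⟨i, rfl⟩ := h k hk
      exact ⟨i, hk, rfl⟩⟩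
  | arrow x y, h => by
    obtain ⟨x₀, rfl⟩ := exists_relabel_eq x fun k hk => h k (Finset.mem_union_left _ hk)
    obtain ⟨y₀, rfl⟩ := exists_relabel_eq y fun k hk => h k (Finset.mem_union_right _ hk)
    exact ⟨arrow x₀ y₀, rfl⟩

variable {d : ι → ℕ} {d' : κ → ℕ} {g} (h : ∀ i, d' (g i) = d i)

theorem bijective_relabel_elem (S : Finset ι) : Function.Bijective
    (fun (c : Cfg d' (S.map g)) (i : S) =>
      (Fin.cast (h i) (c ⟨g i, Finset.mem_map_of_mem g i.2⟩) : Fin (d i))) := by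
  obtain rfl : d = fun i => d' (g i) := funext fun i => (h i).symm
  constructor
  · intro c₁ c₂ he
    funext ⟨k, hk⟩
    obtain ⟨i, hi, rfl⟩ := Finset.mem_map.1 hk
    exact congrFun he ⟨i, hi⟩
  · intro c
    have key : ∀ k : S.map g, g ((S.equivMap g).symm k) = k := fun k => by
      conv_rhs => rw [← (S.equivMap g).apply_symm_apply k]
      rfl
    refine ⟨fun k => Fin.cast (congrArg d' (key k)) (c ((S.equivMap g).symm k)), ?_⟩
    funext i
    have hi : (S.equivMap g).symm ⟨g i, Finset.mem_map_of_mem g i.2⟩ = i :=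
      (S.equivMap g).symm_apply_apply i
    have : ∀ j, j = i → (c j : ℕ) = c i := by rintro _ rfl; rfl
    exact Fin.ext (this _ hi)

variable [DecidableEq ι] [DecidableEq κ]

variable (g) in
theorem ele_relabel : ∀ z : HType ι, (z.relabel g).ele = z.ele.map g
  | elem _ => rfl
  | arrow x y => by
    rw [relabel, ele, ele, ele_relabel x, ele_relabel y, Finset.map_union]

variable (g) in
theorem labelsDistinct_relabel : ∀ z : HType ι, (z.relabel g).LabelsDistinct ↔ z.LabelsDistinct
  | elem _ => Iff.rfl
  | arrow x y => by
    rw [relabel, LabelsDistinct, LabelsDistinct, labelsDistinct_relabel x,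
      labelsDistinct_relabel y, ele_relabel, ele_relabel, Finset.disjoint_map]

/-- The identification of the basis labels of a relabelled type with those of the type. -/
noncomputable def relabelEquiv : (z : HType ι) → Idx d' (z.relabel g) ≃ Idx d z
  | elem S => Equiv.ofBijective _ (bijective_relabel_elem h S)
  | arrow x y => Equiv.prodCongr (relabelEquiv x) (relabelEquiv y)

end
end HType

section
variable {ι κ : Type} {g : ι ↪ κ} {d : ι → ℕ} {d' : κ → ℕ}

/-- The restriction of a total configuration along an embedding of the labels. -/
def TotalCfg.pull (h : ∀ i, d' (g i) = d i) (c : TotalCfg d') : TotalCfg d :=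
  fun i => Fin.cast (h i) (c (g i))

theorem TotalCfg.exists_pull_eq (hd' : ∀ k, 0 < d' k) (h : ∀ i, d' (g i) = d i) (c : TotalCfg d) :
    ∃ c' : TotalCfg d', c'.pull h = c := by
  classical
  refine ⟨fun k => if hk : ∃ i, g i = k then
    Fin.cast (by rw [← h, hk.choose_spec]) (c hk.choose) else ⟨0, hd' k⟩, ?_⟩
  funext i
  have hk : ∃ j, g j = g i := ⟨i, rfl⟩
  have hj : hk.choose = i := g.injective hk.choose_spec
  have : ∀ j, j = i → (c j : ℕ) = c i := by rintro _ rfl; rfl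
  apply Fin.ext
  simp only [TotalCfg.pull, dif_pos hk]
  exact this _ hj

namespace HType
variable (h : ∀ i, d' (g i) = d i)

theorem relabelEquiv_readTotal : ∀ (z : HType ι) (c : TotalCfg d'),
    relabelEquiv h z ((z.relabel g).readTotal c) = z.readTotal (c.pull h)
  | elem _, _ => rfl
  | arrow x y, c => Prod.ext (relabelEquiv_readTotal x c) (relabelEquiv_readTotal y c)

theorem choiApply_submatrix {a b a' b' : Type} [Fintype a] [Fintype a'] (e : a' ≃ a) (f : b' ≃ b)
    (ρ : Matrix a a ℂ) (M : Matrix (a × b) (a × b) ℂ) :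
    choiApply (ρ.submatrix e e) (M.submatrix (e.prodCongr f) (e.prodCongr f)) =
      (choiApply ρ M).submatrix f f := by
  ext p q
  simp only [choiApply_apply, Matrix.submatrix_apply, Equiv.prodCongr_apply, Prod.map]
  rw [← Equiv.sum_comp e]
  exact Finset.sum_congr rfl fun s _ => (Equiv.sum_comp e fun t => ρ (e s) t * M (e s, f p) (t, f q))

variable [DecidableEq ι] [DecidableEq κ]

theorem submatrix_mem_aff_relabel : ∀ (z : HType ι) (M : Matrix (Idx d z) (Idx d z) ℂ),
    M.submatrix (relabelEquiv h z) (relabelEquiv h z) ∈ aff d' (z.relabel g) ↔ M ∈ aff d z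
  | elem S, M => by
    refine mem_aff_elem.trans (Iff.trans (Iff.of_eq (congrArg (· = 1) ?_)) mem_aff_elem.symm)
    exact Equiv.sum_comp (relabelEquiv h (elem S)) fun i => M i i
  | arrow x y, M => by
    have key : ∀ ρ : Matrix (Idx d x) (Idx d x) ℂ,
        choiApply (ρ.submatrix (relabelEquiv h x) (relabelEquiv h x))
          (M.submatrix (relabelEquiv h (arrow x y)) (relabelEquiv h (arrow x y))) =
        (choiApply ρ (M : Matrix (Idx d x × Idx d y) (Idx d x × Idx d y) ℂ)).submatrix
          (relabelEquiv h y) (relabelEquiv h y) := fun ρ => choiApply_submatrix _ _ _ _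
    refine mem_aff_arrow.trans (Iff.trans ?_ mem_aff_arrow.symm)
    constructor
    · intro H ρ hρ
      rw [← submatrix_mem_aff_relabel y, ← key]
      exact H _ ((submatrix_mem_aff_relabel x ρ).2 hρ)
    · intro H ρ hρ
      obtain ⟨σ, rfl⟩ : ∃ σ : Matrix (Idx d x) (Idx d x) ℂ,
          σ.submatrix (relabelEquiv h x) (relabelEquiv h x) = ρ :=
        ⟨ρ.submatrix (relabelEquiv h x).symm (relabelEquiv h x).symm, by ext; simp⟩
      have h1 := H _ ((submatrix_mem_aff_relabel x σ).1 hρ)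
      rw [← submatrix_mem_aff_relabel y, ← key] at h1
      exact h1

theorem mem_T1_relabel_iff (hd : ∀ i, 0 < d i) (hd' : ∀ k, 0 < d' k) {z : HType ι}
    {R : LabelledOp d} {R' : LabelledOp d'} (hs : R'.supp = R.supp.map g)
    (hR : ∀ c c', R'.ev c c' = R.ev (c.pull h) (c'.pull h)) :
    R' ∈ T1 d' (z.relabel g) ↔ R ∈ T1 d z := by
  rw [mem_T1_iff hd, mem_T1_iff hd', ele_relabel, hs, Finset.map_inj]
  refine and_congr_right fun _ => ⟨?_, ?_⟩
  · rintro ⟨M, h1, h2, h3⟩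
    have e : (M.submatrix (relabelEquiv h z).symm (relabelEquiv h z).symm).submatrix
        (relabelEquiv h z) (relabelEquiv h z) = M := by ext; simp
    refine ⟨M.submatrix (relabelEquiv h z).symm (relabelEquiv h z).symm, h1.submatrix _, ?_, ?_⟩
    · rwa [← submatrix_mem_aff_relabel h, e]
    · intro c c'
      -- Pulling back is surjective, so kernels need only be compared at pulled-back configurations.
      obtain ⟨c, rfl⟩ := TotalCfg.exists_pull_eq hd' h c
      obtain ⟨c', rfl⟩ := TotalCfg.exists_pull_eq hd' h c'
      rw [← hR, h3, ← relabelEquiv_readTotal, ← relabelEquiv_readTotal]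
      simp
  · rintro ⟨M, h1, h2, h3⟩
    refine ⟨_, h1.submatrix (relabelEquiv h z), (submatrix_mem_aff_relabel h z M).2 h2, ?_⟩
    intro c c'
    rw [hR, h3, ← relabelEquiv_readTotal, ← relabelEquiv_readTotal]
    rfl

end HType
end

/-! ## Tensor products of types -/

section
variable {a b u : Type} [Fintype a] [Fintype b]

/-- The product operator `R ⊗ S`, with one-dimensional factors inserted. -/
def tensorOp (R : Matrix a a ℂ) (S : Matrix b b ℂ) :
    Matrix ((a × (b × u)) × u) ((a × (b × u)) × u) ℂ :=
  (Matrix.kroneckerMap (· * ·) R S).submatrix (fun p => (p.1.1, p.1.2.1))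
    (fun p => (p.1.1, p.1.2.1))

theorem tensorOp_posSemidef {R : Matrix a a ℂ} {S : Matrix b b ℂ} (hR : R.PosSemidef)
    (hS : S.PosSemidef) : (tensorOp (u := u) R S).PosSemidef :=
  (hR.kronecker hS).submatrix _

variable [Fintype u] [Unique u]

/-- The bilinear pairing `∑ K s t * W s t`, where `W` may carry a one-dimensional factor. -/
def dualPairing : Matrix a a ℂ →ₗ[ℂ] Matrix (a × u) (a × u) ℂ →ₗ[ℂ] ℂ :=
  choiApply.compr₂ (Matrix.traceLinearMap u ℂ ℂ)

theorem dualPairing_apply (K : Matrix a a ℂ) (W : Matrix (a × u) (a × u) ℂ) :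
    dualPairing K W = ∑ s, ∑ t, K s t * W (s, default) (t, default) := by
  change Matrix.trace (choiApply K W) = _
  rw [Matrix.trace, Fintype.sum_unique]
  rfl

theorem dualPairing_tensorOp (R : Matrix a a ℂ) (S : Matrix b b ℂ)
    (K : Matrix (a × (b × u)) (a × (b × u)) ℂ) :
    dualPairing K (tensorOp (u := u) R S) = dualPairing S (choiApply R K) := by
  simp only [dualPairing_apply, tensorOp, Matrix.submatrix_apply, Matrix.kroneckerMap_apply,
    Fintype.sum_prod_type, Fintype.sum_unique, choiApply_apply, Finset.mul_sum]
  rw [Finset.sum_comm]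
  refine Finset.sum_congr rfl fun s' _ => ?_
  refine ((Finset.sum_congr rfl fun s _ => Finset.sum_comm).trans Finset.sum_comm).trans ?_
  refine Finset.sum_congr rfl fun t' _ => Finset.sum_congr rfl fun s _ =>
    Finset.sum_congr rfl fun t _ => ?_
  ring

theorem exists_eq_dualPairing (f : Matrix (a × u) (a × u) ℂ →ₗ[ℂ] ℂ) :
    ∃ K : Matrix a a ℂ, ∀ W, dualPairing K W = f W := by
  classical
  refine ⟨Matrix.of fun s t => f (Matrix.single (s, default) (t, default) 1), fun W => ?_⟩
  conv_rhs => rw [Matrix.matrix_eq_sum_single W]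
  simp only [map_sum, Fintype.sum_prod_type, Fintype.sum_unique]
  rw [dualPairing_apply]
  refine Finset.sum_congr rfl fun s _ => Finset.sum_congr rfl fun t _ => ?_
  rw [Matrix.of_apply, mul_comm, ← smul_eq_mul, ← map_smul, Matrix.smul_single, smul_eq_mul, mul_one]

/-- An operator which pairs to `1` with all operators that pair to `1` with the products `R ⊗ S`,
`R ∈ A`, `S ∈ B`, is an affine combination of such products. -/
theorem exists_eq_sum_tensorOp_of_forall {A : Set (Matrix a a ℂ)} {B : Set (Matrix b b ℂ)}
    (hne : ∃ K : Matrix (a × (b × u)) (a × (b × u)) ℂ,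
      ∀ R ∈ A, ∀ S ∈ B, dualPairing S (choiApply R K) = 1)
    {W : Matrix ((a × (b × u)) × u) ((a × (b × u)) × u) ℂ}
    (hW : ∀ K : Matrix (a × (b × u)) (a × (b × u)) ℂ,
      (∀ R ∈ A, ∀ S ∈ B, dualPairing S (choiApply R K) = 1) → dualPairing K W = 1) :
    ∃ (n : ℕ) (c : Fin n → ℂ) (R : Fin n → Matrix a a ℂ) (S : Fin n → Matrix b b ℂ),
      ∑ k, c k = 1 ∧ (∀ k, R k ∈ A) ∧ (∀ k, S k ∈ B) ∧ W = ∑ k, c k • tensorOp (R k) (S k) := by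
  obtain ⟨K, hK⟩ := hne
  have hspan : W ∈ Submodule.span ℂ (Set.image2 tensorOp A B) := by
    -- A functional that kills all products but not `W` is pairing with some `K₀`. Then `K + K₀`
    -- still pairs to `1` with every product, yet its pairing with `W` differs from that of `K`.
    by_contra hn
    obtain ⟨f, hf, hP⟩ := Submodule.exists_le_ker_of_notMem hn
    obtain ⟨K₀, hK₀⟩ := exists_eq_dualPairing f
    have h1 := hW (K + K₀) fun R hR S hS => by
      have h2 : dualPairing S (choiApply R K₀) = 0 := by
        rw [← dualPairing_tensorOp, hK₀]
        exact hP (Submodule.subset_span ⟨R, hR, S, hS, rfl⟩)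
      rw [map_add, map_add, hK R hR S hS, h2, add_zero]
    rw [map_add, LinearMap.add_apply, hW K hK, hK₀] at h1
    exact hf (add_eq_left.1 h1)
  obtain ⟨n, c, V, hV⟩ := Submodule.mem_span_set'.1 hspan
  choose R hR S hS hRS using fun k => (V k).2
  have hV' : W = ∑ k, c k • tensorOp (R k) (S k) := by
    rw [← hV]
    exact Finset.sum_congr rfl fun k _ => by rw [hRS k]
  refine ⟨n, c, R, S, ?_, hR, hS, hV'⟩
  -- Pairing the expansion of `W` with `K` evaluates each product to `1`, which leaves the sum of
  -- the weights.
  rw [← hW K hK, hV', map_sum]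
  refine Finset.sum_congr rfl fun k _ => ?_
  rw [map_smul, dualPairing_tensorOp, hK _ (hR k) _ (hS k), smul_eq_mul, mul_one]

end

namespace HType
section
variable {ι : Type} [DecidableEq ι] {d : ι → ℕ}

instance instUniqueIdxTriv : Unique (Idx d (triv : HType ι)) :=
  inferInstanceAs (Unique ((i : (∅ : Finset ι)) → Fin (d i)))

theorem mem_aff_dual {w : HType ι} {W : Matrix (Idx d w × Idx d triv) (Idx d w × Idx d triv) ℂ} :
    (W : Matrix (Idx d (dual w)) (Idx d (dual w)) ℂ) ∈ aff d (dual w) ↔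
      ∀ K ∈ aff d w, dualPairing K W = 1 :=
  mem_aff_arrow.trans (forall₂_congr fun _ _ => mem_aff_elem)

theorem tensorOp_mem_aff {x y : HType ι} {R : Matrix (Idx d x) (Idx d x) ℂ}
    {S : Matrix (Idx d y) (Idx d y) ℂ} (hR : R ∈ aff d x) (hS : S ∈ aff d y) :
    (tensorOp (u := Idx d triv) R S : Matrix (Idx d (tensor x y)) (Idx d (tensor x y)) ℂ) ∈
      aff d (tensor x y) :=
  mem_aff_dual.2 fun _ hK => (dualPairing_tensorOp R S _).trans
    (mem_aff_dual.1 (mem_aff_arrow.1 hK R hR) S hS)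

/-- Deterministic maps of type `x ⊗ y` are affine combinations of product maps. -/
theorem exists_eq_sum_tensorOp (hd : ∀ i, 0 < d i) {x y : HType ι}
    {W : Matrix (Idx d (tensor x y)) (Idx d (tensor x y)) ℂ} (hW : W ∈ aff d (tensor x y)) :
    ∃ (n : ℕ) (c : Fin n → ℂ) (R : Fin n → Matrix (Idx d x) (Idx d x) ℂ)
      (S : Fin n → Matrix (Idx d y) (Idx d y) ℂ), ∑ k, c k = 1 ∧
      (∀ k, (R k).PosSemidef ∧ R k ∈ aff d x) ∧ (∀ k, (S k).PosSemidef ∧ S k ∈ aff d y) ∧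
      (W : Matrix ((Idx d x × (Idx d y × Idx d triv)) × Idx d triv)
        ((Idx d x × (Idx d y × Idx d triv)) × Idx d triv) ℂ) =
        ∑ k, c k • tensorOp (R k) (S k) := by
  refine exists_eq_sum_tensorOp_of_forall (A := {R | R.PosSemidef ∧ R ∈ aff d x})
    (B := {S | S.PosSemidef ∧ S ∈ aff d y}) ?_ fun _ hK => ?_
  · obtain ⟨K, -, hK⟩ := exists_posSemidef_mem_aff hd (arrow x (dual y))
    exact ⟨K, fun R hR S hS => mem_aff_dual.1 (mem_aff_arrow.1 hK R hR.2) S hS.2⟩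
  -- Pairing to `1` with all positive products puts `K` in the affine space of `x → ȳ`: positive
  -- inputs are tested on one arrow after the other.
  · refine mem_aff_dual.1 hW _ ?_
    refine choiApply_mem_aff_of_posSemidef hd fun R hR hR' => ?_
    refine choiApply_mem_aff_of_posSemidef hd fun S hS hS' => mem_aff_elem.2 ?_
    exact hK R ⟨hR', hR⟩ S ⟨hS', hS⟩

/-- There are countably many types with labels in a given finite set. -/
theorem countable_setOf_ele_subset (K : Finset ι) : {z : HType ι | z.ele ⊆ K}.Countable := by
  -- `Z n` consists of types with arrows nested at most `n` deep.
  let Z : ℕ → Set (HType ι) := fun n =>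
    Nat.rec (elem '' {S | S ⊆ K}) (fun _ A => A ∪ Set.image2 arrow A A) n
  have hZ : ∀ n, Z (n + 1) = Z n ∪ Set.image2 arrow (Z n) (Z n) := fun _ => rfl
  have hc : ∀ n, (Z n).Countable := by
    intro n
    induction n with
    | zero =>
      refine Set.Countable.image (Set.Finite.countable ?_) _
      exact (Finset.finite_toSet K.powerset).subset fun S hS => by simpa using hS
    | succ n ih => rw [hZ]; exact ih.union (ih.image2 ih _)
  have hmono : Monotone Z := monotone_nat_of_le_succ fun n => by
    rw [hZ]; exact Set.subset_union_left
  refine (Set.countable_iUnion hc).mono fun z hz => Set.mem_iUnion.2 ?_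
  induction z with
  | elem S => exact ⟨0, S, hz, rfl⟩
  | arrow x y ihx ihy =>
    obtain ⟨m, hm⟩ := ihx (Finset.union_subset_left hz)
    obtain ⟨n, hn⟩ := ihy (Finset.union_subset_right hz)
    refine ⟨max m n + 1, ?_⟩
    rw [hZ]
    exact Or.inr (Set.mem_image2_of_mem (hmono (le_max_left _ _) hm) (hmono (le_max_right _ _) hn))

end
end HType

/-- The exponents `i + n * j` with `i, j < n` are pairwise distinct, so the `a i j` are exactly the
coefficients of one polynomial with infinitely many roots. -/
theorem eq_zero_of_infinite_sum_pow_eq_zero {n : ℕ} (a : Fin n → Fin n → ℂ) {T : Set ℝ}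
    (hT : T.Infinite) (h : ∀ t ∈ T, ∑ i : Fin n, ∑ j : Fin n,
      (t : ℂ) ^ (i : ℕ) * (t : ℂ) ^ (n * j) * a i j = 0)
    (i j : Fin n) : a i j = 0 := by
  let p : Polynomial ℂ := ∑ i : Fin n, ∑ j : Fin n,
    Polynomial.C (a i j) * Polynomial.X ^ (finProdFinEquiv (j, i) : ℕ)
  have hp : p = 0 := by
    refine Polynomial.eq_zero_of_infinite_isRoot p
      ((hT.image Complex.ofReal_injective.injOn).mono ?_)
    rintro _ ⟨t, ht, rfl⟩
    change p.eval (t : ℂ) = 0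
    rw [← h t ht]
    simp only [p, Polynomial.eval_finsetSum, Polynomial.eval_mul, Polynomial.eval_C,
      Polynomial.eval_pow, Polynomial.eval_X, finProdFinEquiv_apply_val, pow_add]
    exact Finset.sum_congr rfl fun i _ => Finset.sum_congr rfl fun j _ => by ring
  have hc : p.coeff (finProdFinEquiv (j, i) : ℕ) = a i j := by
    simp only [p, Polynomial.finsetSum_coeff, Polynomial.coeff_C_mul, Polynomial.coeff_X_pow,
      Fin.val_inj, finProdFinEquiv.apply_eq_iff_eq, Prod.mk.injEq]
    simp [ite_and]
  rw [← hc, hp, Polynomial.coeff_zero]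

/-! ## Contraction of a product of two labelled operators -/

section
variable {ι : Type} [DecidableEq ι]

/-- The embedding which sends the labels in `U` to the first copy and all others to the second. -/
def splitEmbedding (U : Finset ι) : ι ↪ ι ⊕ ι where
  toFun a := if a ∈ U then .inl a else .inr a
  inj' a b h := by
    dsimp only at h
    split_ifs at h <;> simpa using h

theorem splitEmbedding_of_mem {U : Finset ι} {a : ι} (ha : a ∈ U) :
    splitEmbedding U a = .inl a := if_pos ha

theorem splitEmbedding_of_notMem {U : Finset ι} {a : ι} (ha : a ∉ U) :
    splitEmbedding U a = .inr a := if_neg ha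

theorem sumElim_splitEmbedding (d : ι → ℕ) (U : Finset ι) (a : ι) :
    Sum.elim d d (splitEmbedding U a) = d a := by
  by_cases ha : a ∈ U
  · rw [splitEmbedding_of_mem ha]; rfl
  · rw [splitEmbedding_of_notMem ha]; rfl

variable {d : ι → ℕ}

theorem pull_splitEmbedding_of_mem {U : Finset ι} (c : TotalCfg (Sum.elim d d)) {a : ι}
    (ha : a ∈ U) : c.pull (sumElim_splitEmbedding d U) a = c (.inl a) := by
  have : ∀ k, k = .inl a → (c k : ℕ) = c (.inl a) := by rintro _ rfl; rfl
  exact Fin.ext (this _ (splitEmbedding_of_mem ha))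

theorem pull_splitEmbedding_of_notMem {U : Finset ι} (c : TotalCfg (Sum.elim d d)) {a : ι}
    (ha : a ∉ U) : c.pull (sumElim_splitEmbedding d U) a = c (.inr a) := by
  have : ∀ k, k = .inr a → (c k : ℕ) = c (.inr a) := by rintro _ rfl; rfl
  exact Fin.ext (this _ (splitEmbedding_of_notMem ha))

/-- A labelled operator on two copies of the labels is the product `R ⊗ S`. -/
structure IsProduct (R S : LabelledOp d) (W : LabelledOp (Sum.elim d d)) : Prop where
  supp : ∀ k, k ∈ W.supp ↔ k.elim (· ∈ R.supp) (· ∈ S.supp)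
  ev : ∀ c c', W.ev c c' = R.ev (fun a => c (.inl a)) (fun a => c' (.inl a)) *
    S.ev (fun a => c (.inr a)) (fun a => c' (.inr a))

/-- Contracting the shared systems of `R ⊗ S` gives the link product of `R` and `S`. -/
theorem IsProduct.contractAll {R S : LabelledOp d} {W : LabelledOp (Sum.elim d d)}
    (h : IsProduct R S W) {l : List ι} (hl : l.Nodup) (hlH : l.toFinset = R.supp ∩ S.supp) :
    (contractAll (l.map fun a => (.inl a, .inr a)) W).supp =
      (link R S).supp.map (splitEmbedding R.supp) ∧
    ∀ c c', (_root_.contractAll (l.map fun a => (.inl a, .inr a)) W).ev c c' =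
      (link R S).ev (c.pull (sumElim_splitEmbedding d R.supp))
        (c'.pull (sumElim_splitEmbedding d R.supp)) := by
  have hmem : ∀ a, a ∈ l ↔ a ∈ R.supp ∧ a ∈ S.supp := fun a => by
    rw [← List.mem_toFinset, hlH, Finset.mem_inter]
  obtain ⟨h1, h2⟩ := contractAll_supp_and_ev W l hl fun a ha =>
    ⟨(h.supp _).2 ((hmem a).1 ha).1, (h.supp _).2 ((hmem a).1 ha).2⟩
  constructor
  · ext k
    rw [h1, h.supp, hmem, Finset.mem_map]
    have hs : ∀ a, a ∈ (link R S).supp ↔ (a ∈ R.supp ∨ a ∈ S.supp) ∧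
        ¬ (a ∈ R.supp ∧ a ∈ S.supp) := fun a => by simp [link]
    constructor
    · rintro ⟨hk, hk'⟩
      rcases k with a | a
      · exact ⟨a, (hs a).2 ⟨Or.inl hk, hk'⟩, splitEmbedding_of_mem hk⟩
      · exact ⟨a, (hs a).2 ⟨Or.inr hk, hk'⟩, splitEmbedding_of_notMem fun hR => hk' ⟨hR, hk⟩⟩
    · rintro ⟨a, ha, rfl⟩
      obtain ⟨ha1, ha2⟩ := (hs a).1 ha
      by_cases haR : a ∈ R.supp
      · rw [splitEmbedding_of_mem haR]
        exact ⟨haR, ha2⟩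
      · rw [splitEmbedding_of_notMem haR]
        exact ⟨ha1.resolve_left haR, ha2⟩
  · intro c c'
    have key : ∀ c : TotalCfg (Sum.elim d d), ∀ h₀ : Cfg d (R.supp ∩ S.supp),
        (∀ a ∈ R.supp, c.overwriteBoth h₀ (.inl a) =
          (c.pull (sumElim_splitEmbedding d R.supp)).overwrite h₀ a) ∧
        (∀ a ∈ S.supp, c.overwriteBoth h₀ (.inr a) =
          (c.pull (sumElim_splitEmbedding d R.supp)).overwrite h₀ a) := by
      intro c h₀
      constructor
      · intro a ha
        by_cases haH : a ∈ R.supp ∩ S.supp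
        · rw [TotalCfg.overwriteBoth_inl_of_mem c h₀ haH, TotalCfg.overwrite_of_mem _ _ haH]
        · rw [TotalCfg.overwriteBoth_of_notMem c h₀ (k := .inl a) haH,
            TotalCfg.overwrite_of_notMem _ _ haH,
            pull_splitEmbedding_of_mem c ha]
      · intro a ha
        by_cases haH : a ∈ R.supp ∩ S.supp
        · rw [TotalCfg.overwriteBoth_inr_of_mem c h₀ haH, TotalCfg.overwrite_of_mem _ _ haH]
        · rw [TotalCfg.overwriteBoth_of_notMem c h₀ (k := .inr a) haH,
            TotalCfg.overwrite_of_notMem _ _ haH,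
            pull_splitEmbedding_of_notMem c fun hR => haH (Finset.mem_inter.2 ⟨hR, ha⟩)]
    rw [h2, hlH, link_ev]
    refine Finset.sum_congr rfl fun h₀ _ => Finset.sum_congr rfl fun h₀' _ => ?_
    rw [h.ev]
    congr 1
    · exact R.ev_congr (key c h₀).1 (key c' h₀').1
    · exact S.ev_congr (key c h₀).2 (key c' h₀').2

theorem exists_list_of_toFinset_eq_sharedPairs {x y : HType ι}
    {L : List ((ι ⊕ ι) × (ι ⊕ ι))} (hL : L.Nodup) (hLH : L.toFinset = sharedPairs x y) :
    ∃ l : List ι, l.Nodup ∧ l.toFinset = x.ele ∩ y.ele ∧ L = l.map fun a => (.inl a, .inr a) := by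
  have hmem : ∀ p, p ∈ L ↔ ∃ a ∈ x.ele ∩ y.ele, (Sum.inl a, Sum.inr a) = p := fun p => by
    rw [← List.mem_toFinset, hLH, sharedPairs, Finset.mem_image]
  have hl : L = (L.map fun p => p.1.elim id id).map fun a => (.inl a, .inr a) := by
    rw [List.map_map]
    conv_lhs => rw [← List.map_id L]
    refine List.map_congr_left fun p hp => ?_
    obtain ⟨a, -, rfl⟩ := (hmem p).1 hp
    rfl
  refine ⟨L.map fun p => p.1.elim id id, List.Nodup.of_map (fun a => (Sum.inl a, Sum.inr a)) (hl ▸ hL),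
    ?_, hl⟩
  ext a
  rw [List.mem_toFinset, List.mem_map]
  constructor
  · rintro ⟨p, hp, rfl⟩
    obtain ⟨a, ha, rfl⟩ := (hmem p).1 hp
    exact ha
  · exact fun ha => ⟨_, (hmem _).2 ⟨a, ha, rfl⟩, rfl⟩

end

/-! ## The operators of a tensor product -/

namespace HType
section
variable {ι : Type} [DecidableEq ι] {d : ι → ℕ}

/-- The identification of the basis labels of the first copy of `x` with those of `x`. -/
noncomputable def inlEquiv {ι : Type} {d : ι → ℕ} (x : HType ι) :
    Idx (Sum.elim d d) (x.relabel Function.Embedding.inl) ≃ Idx d x :=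
  relabelEquiv (g := Function.Embedding.inl) (d := d) (d' := Sum.elim d d) (fun _ => rfl) x

/-- The identification of the basis labels of the second copy of `y` with those of `y`. -/
noncomputable def inrEquiv {ι : Type} {d : ι → ℕ} (y : HType ι) :
    Idx (Sum.elim d d) (y.relabel Function.Embedding.inr) ≃ Idx d y :=
  relabelEquiv (g := Function.Embedding.inr) (d := d) (d' := Sum.elim d d) (fun _ => rfl) y

theorem inlEquiv_readTotal {ι : Type} {d : ι → ℕ} (x : HType ι) (c : TotalCfg (Sum.elim d d)) :
    inlEquiv x ((x.relabel Function.Embedding.inl).readTotal c) =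
      x.readTotal (d := d) fun a => c (.inl a) :=
  relabelEquiv_readTotal (g := Function.Embedding.inl) (d := d) (d' := Sum.elim d d)
    (fun _ => rfl) x c

theorem inrEquiv_readTotal {ι : Type} {d : ι → ℕ} (y : HType ι) (c : TotalCfg (Sum.elim d d)) :
    inrEquiv y ((y.relabel Function.Embedding.inr).readTotal c) =
      y.readTotal (d := d) fun a => c (.inr a) :=
  relabelEquiv_readTotal (g := Function.Embedding.inr) (d := d) (d' := Sum.elim d d)
    (fun _ => rfl) y c

/-- The operator `R ⊗ S` on the disjoint copies of `H_x` and `H_y`. -/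
noncomputable def disjointTensorOp {ι : Type} {d : ι → ℕ} {x y : HType ι} (R : Matrix (Idx d x) (Idx d x) ℂ)
    (S : Matrix (Idx d y) (Idx d y) ℂ) :
    Matrix (Idx (Sum.elim d d) (disjointTensor x y)) (Idx (Sum.elim d d) (disjointTensor x y)) ℂ :=
  tensorOp (u := Idx (Sum.elim d d) triv) (R.submatrix (inlEquiv x) (inlEquiv x))
    (S.submatrix (inrEquiv y) (inrEquiv y))

theorem disjointTensorOp_posSemidef {x y : HType ι} {R : Matrix (Idx d x) (Idx d x) ℂ}
    {S : Matrix (Idx d y) (Idx d y) ℂ} (hR : R.PosSemidef) (hS : S.PosSemidef) :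
    (disjointTensorOp R S).PosSemidef :=
  tensorOp_posSemidef (hR.submatrix _) (hS.submatrix _)

theorem disjointTensorOp_mem_aff {x y : HType ι} {R : Matrix (Idx d x) (Idx d x) ℂ}
    {S : Matrix (Idx d y) (Idx d y) ℂ} (hR : R ∈ aff d x) (hS : S ∈ aff d y) :
    disjointTensorOp R S ∈ aff (Sum.elim d d) (disjointTensor x y) :=
  tensorOp_mem_aff ((submatrix_mem_aff_relabel _ x R).2 hR) ((submatrix_mem_aff_relabel _ y S).2 hS)

theorem disjointTensorOp_apply_readTotal {ι : Type} {d : ι → ℕ} {x y : HType ι} (R : Matrix (Idx d x) (Idx d x) ℂ)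
    (S : Matrix (Idx d y) (Idx d y) ℂ) (c c' : TotalCfg (Sum.elim d d)) :
    disjointTensorOp R S ((disjointTensor x y).readTotal c) ((disjointTensor x y).readTotal c') =
      R (x.readTotal fun a => c (.inl a)) (x.readTotal fun a => c' (.inl a)) *
      S (y.readTotal fun a => c (.inr a)) (y.readTotal fun a => c' (.inr a)) := by
  simp only [← inlEquiv_readTotal, ← inrEquiv_readTotal]
  rfl

theorem isProduct_label_disjointTensorOp {x y : HType ι} (R : Matrix (Idx d x) (Idx d x) ℂ)
    (S : Matrix (Idx d y) (Idx d y) ℂ) :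
    IsProduct (x.label R) (y.label S) ((disjointTensor x y).label (disjointTensorOp R S)) where
  supp k := by
    change k ∈ ((x.relabel Function.Embedding.inl).ele ∪
      ((y.relabel Function.Embedding.inr).ele ∪ ∅)) ∪ ∅ ↔ k.elim (· ∈ x.ele) (· ∈ y.ele)
    rw [ele_relabel, ele_relabel]
    rcases k with a | a <;> simp
  ev c c' := by
    refine (label_ev _ _ _ _).trans ((disjointTensorOp_apply_readTotal R S c c').trans ?_)
    exact (congrArg₂ (· * ·) (label_ev x R _ _) (label_ev y S _ _)).symm

theorem exists_eq_sum_disjointTensorOp (hd : ∀ i, 0 < d i) {x y : HType ι}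
    {W : Matrix (Idx (Sum.elim d d) (disjointTensor x y))
      (Idx (Sum.elim d d) (disjointTensor x y)) ℂ}
    (hW : W ∈ aff (Sum.elim d d) (disjointTensor x y)) :
    ∃ (n : ℕ) (c : Fin n → ℂ) (R : Fin n → Matrix (Idx d x) (Idx d x) ℂ)
      (S : Fin n → Matrix (Idx d y) (Idx d y) ℂ), ∑ k, c k = 1 ∧
      (∀ k, (R k).PosSemidef ∧ R k ∈ aff d x) ∧ (∀ k, (S k).PosSemidef ∧ S k ∈ aff d y) ∧
      ∀ p q, W p q = ∑ k, c k * disjointTensorOp (R k) (S k) p q := by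
  have hd' : ∀ k, 0 < Sum.elim d d k := by rintro (i | i) <;> exact hd i
  obtain ⟨n, c, R, S, hc, hR, hS, hW⟩ := exists_eq_sum_tensorOp hd' hW
  have eR : ∀ k, ((R k).submatrix (inlEquiv x).symm (inlEquiv x).symm).submatrix
      (inlEquiv x) (inlEquiv x) = R k := fun k => by ext; simp
  have eS : ∀ k, ((S k).submatrix (inrEquiv y).symm (inrEquiv y).symm).submatrix
      (inrEquiv y) (inrEquiv y) = S k := fun k => by ext; simp
  refine ⟨n, c, fun k => (R k).submatrix (inlEquiv x).symm (inlEquiv x).symm,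
    fun k => (S k).submatrix (inrEquiv y).symm (inrEquiv y).symm, hc,
    fun k => ⟨(hR k).1.submatrix _, ?_⟩, fun k => ⟨(hS k).1.submatrix _, ?_⟩, fun p q => ?_⟩
  · refine (submatrix_mem_aff_relabel (g := Function.Embedding.inl) (d' := Sum.elim d d)
      (fun _ => rfl) x _).1 ?_
    exact (eR k).symm ▸ (hR k).2
  · refine (submatrix_mem_aff_relabel (g := Function.Embedding.inr) (d' := Sum.elim d d)
      (fun _ => rfl) y _).1 ?_
    exact (eS k).symm ▸ (hS k).2
  · have e : ∀ p q : (Idx (Sum.elim d d) (x.relabel Function.Embedding.inl) ×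
        (Idx (Sum.elim d d) (y.relabel Function.Embedding.inr) × Idx (Sum.elim d d) triv)) ×
          Idx (Sum.elim d d) triv,
        (∑ k, c k • tensorOp (R k) (S k)) p q = ∑ k, c k * tensorOp (R k) (S k) p q :=
      fun p q => by simp [Matrix.sum_apply]
    refine ((congrFun (congrFun hW p) q).trans (e p q)).trans ?_
    refine Finset.sum_congr rfl fun k _ => ?_
    simp only [disjointTensorOp, eR, eS]

/-! ## Link products of affine combinations -/

theorem link_label_sum_ev {x y : HType ι} {κ : Type} [Fintype κ] (a b : κ → ℂ)
    (R : κ → Matrix (Idx d x) (Idx d x) ℂ) (S : κ → Matrix (Idx d y) (Idx d y) ℂ)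
    (c c' : TotalCfg d) :
    (link (x.label (∑ i, a i • R i)) (y.label (∑ j, b j • S j))).ev c c' =
      ∑ i, ∑ j, a i * b j * (link (x.label (R i)) (y.label (S j))).ev c c' := by
  simp only [link_ev, label_ev]
  change ∑ h : Cfg d (x.ele ∩ y.ele), ∑ h' : Cfg d (x.ele ∩ y.ele), _ =
    ∑ i, ∑ j, a i * b j * ∑ h : Cfg d (x.ele ∩ y.ele), ∑ h' : Cfg d (x.ele ∩ y.ele), _
  simp only [Matrix.sum_apply, Matrix.smul_apply, smul_eq_mul, Finset.sum_mul_sum]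
  simp only [Finset.mul_sum]
  refine (Finset.sum_congr rfl fun h _ => Finset.sum_comm).trans ?_
  refine Finset.sum_comm.trans (Finset.sum_congr rfl fun i _ => ?_)
  refine (Finset.sum_congr rfl fun h _ => Finset.sum_comm).trans ?_
  refine Finset.sum_comm.trans (Finset.sum_congr rfl fun j _ => ?_)
  refine Finset.sum_congr rfl fun h _ => Finset.sum_congr rfl fun h' _ => ?_
  exact mul_mul_mul_comm _ _ _ _

/-- The weights of a point of the curve through affine combinations of `n` points. -/
noncomputable def curveWeight {n : ℕ} (e : Fin n → ℕ) (t : ℝ) (i : Fin n) : ℝ := t ^ e i / ∑ j, t ^ e j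

theorem curveSum_pos {n : ℕ} (hn : 0 < n) (e : Fin n → ℕ) {t : ℝ} (ht : 0 < t) :
    0 < ∑ j, t ^ e j :=
  Finset.sum_pos (fun _ _ => pow_pos ht _) ⟨⟨0, hn⟩, Finset.mem_univ _⟩

theorem sum_curveWeight_smul_posSemidef_mem_aff {n : ℕ} (hn : 0 < n) (e : Fin n → ℕ) {t : ℝ}
    (ht : 0 < t) {x : HType ι} {R : Fin n → Matrix (Idx d x) (Idx d x) ℂ}
    (hR : ∀ k, (R k).PosSemidef ∧ R k ∈ aff d x) :
    (∑ i, (curveWeight e t i : ℂ) • R i).PosSemidef ∧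
      ∑ i, (curveWeight e t i : ℂ) • R i ∈ aff d x := by
  have hpos := curveSum_pos hn e ht
  refine ⟨Matrix.posSemidef_sum _ fun i _ => (hR i).1.smul ?_, sum_smul_mem_aff _ ?_ fun i _ => (hR i).2⟩
  · exact_mod_cast (div_nonneg (pow_pos ht _).le hpos.le : 0 ≤ curveWeight e t i)
  · rw [← Complex.ofReal_sum]
    simp only [curveWeight]
    rw [← Finset.sum_div, div_self hpos.ne', Complex.ofReal_one]

/-- If the link products along a curve through all pairs of points are deterministic of type `z`
infinitely often, then all link products of the points lie in the affine space of `z`. -/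
theorem link_mem_aff_of_infinite {x y z : HType ι} (hd : ∀ i, 0 < d i) {n : ℕ} (hn : 0 < n)
    {R : Fin n → Matrix (Idx d x) (Idx d x) ℂ} {S : Fin n → Matrix (Idx d y) (Idx d y) ℂ}
    {sec : Idx d z → TotalCfg d} (hsec : ∀ p, z.readTotal (sec p) = p) {T : Set ℝ}
    (hT : T.Infinite) (hT0 : ∀ t ∈ T, 0 < t)
    (h : ∀ t ∈ T, link (x.label (∑ i, (curveWeight (fun k => (k : ℕ)) t i : ℂ) • R i))
      (y.label (∑ j, (curveWeight (fun k => n * k) t j : ℂ) • S j)) ∈ T1 d z) (i j : Fin n) :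
    (Matrix.of fun p q => (link (x.label (R i)) (y.label (S j))).ev (sec p) (sec q)) ∈
      aff d z := by
  intro φ hφ
  let N : Fin n → Fin n → Matrix (Idx d z) (Idx d z) ℂ := fun i j =>
    Matrix.of fun p q => (link (x.label (R i)) (y.label (S j))).ev (sec p) (sec q)
  -- The weights sum to `1`, so the constraint along the curve is equivalent to the vanishing of a
  -- polynomial with coefficients `φ (N i j) - 1`.
  refine sub_eq_zero.1
    (eq_zero_of_infinite_sum_pow_eq_zero (fun i j => φ (N i j) - 1) hT (fun t ht => ?_) i j)
  obtain ⟨-, M, -, hM, hev⟩ := (mem_T1_iff hd).1 (h t ht)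
  have hMN : M = ∑ i, ∑ j, ((curveWeight (fun k => (k : ℕ)) t i : ℂ) *
      (curveWeight (fun k => n * k) t j : ℂ)) • N i j := by
    ext p q
    have := hev (sec p) (sec q)
    rw [hsec, hsec, link_label_sum_ev] at this
    rw [← this]
    simp [Matrix.sum_apply, N]
  have h1 : (0 : ℝ) < ∑ k : Fin n, t ^ (k : ℕ) := curveSum_pos hn _ (hT0 t ht)
  have h2 : (0 : ℝ) < ∑ k : Fin n, t ^ (n * k) := curveSum_pos hn _ (hT0 t ht)
  have h1' : (∑ k : Fin n, (t : ℂ) ^ (k : ℕ)) ≠ 0 := by exact_mod_cast h1.ne'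
  have h2' : (∑ k : Fin n, (t : ℂ) ^ (n * k : ℕ)) ≠ 0 := by exact_mod_cast h2.ne'
  have hφM := hM φ hφ
  rw [hMN] at hφM
  simp only [map_sum, map_smul, smul_eq_mul, curveWeight] at hφM
  push_cast at hφM
  have h3 : ∑ i : Fin n, ∑ j : Fin n, (t : ℂ) ^ (i : ℕ) * (t : ℂ) ^ (n * j : ℕ) * φ (N i j) =
      (∑ k : Fin n, (t : ℂ) ^ (k : ℕ)) * ∑ k : Fin n, (t : ℂ) ^ (n * k : ℕ) := by
    rw [← mul_one ((∑ k : Fin n, (t : ℂ) ^ (k : ℕ)) * _), ← hφM, Finset.mul_sum]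
    refine Finset.sum_congr rfl fun i _ => ?_
    rw [Finset.mul_sum]
    refine Finset.sum_congr rfl fun j _ => ?_
    field_simp
  simp only [mul_sub, mul_one, Finset.sum_sub_distrib]
  rw [h3, Finset.sum_mul_sum, sub_self]

/-- If `x * y` is admissible, some type `z` contains infinitely many points of a curve. -/
theorem exists_infinite_link_mem_T1 {x y : HType ι} (hxy : CompositionAdmissible d x y)
    {R : ℝ → LabelledOp d} {S : ℝ → LabelledOp d} (hR : ∀ t, 0 < t → R t ∈ T1 d x)
    (hS : ∀ t, 0 < t → S t ∈ T1 d y) :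
    ∃ z : HType ι, z.LabelsDistinct ∧ {t | 0 < t ∧ link (R t) (S t) ∈ T1 d z}.Infinite := by
  by_contra! hfin
  -- The support of the link product bounds the labels of `z`, so only countably many types compete
  -- even if `ι` is uncountable.
  have hsub : Set.Ioi (0 : ℝ) ⊆ ⋃ z ∈ {z : HType ι | z.ele ⊆ x.ele ∪ y.ele},
      {t | (0 < t ∧ link (R t) (S t) ∈ T1 d z) ∧ z.LabelsDistinct} := by
    intro t ht
    obtain ⟨z, hz, hzt⟩ := hxy _ (hR t ht) _ (hS t ht)
    refine Set.mem_biUnion ?_ ⟨⟨ht, hzt⟩, hz⟩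
    obtain ⟨M, -, hM⟩ := hzt
    obtain ⟨M₁, -, h₁⟩ := hR t ht
    obtain ⟨M₂, -, h₂⟩ := hS t ht
    have h3 : (link (R t) (S t)).supp = z.ele := congrArg LabelledOp.supp hM
    have h4 : (R t).supp = x.ele := congrArg LabelledOp.supp h₁
    have h5 : (S t).supp = y.ele := congrArg LabelledOp.supp h₂
    change z.ele ⊆ _
    rw [← h3, ← h4, ← h5]
    exact Finset.sdiff_subset
  have hcount : (Set.Ioi (0 : ℝ)).Countable := by
    refine ((countable_setOf_ele_subset _).biUnion fun z _ => ?_).mono hsub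
    by_cases hz : z.LabelsDistinct
    · refine ((hfin z hz).subset ?_).countable
      exact fun t ht => ht.1
    · convert Set.countable_empty
      exact Set.eq_empty_of_forall_notMem fun t ht => hz ht.2
  have := hcount.le_aleph0
  rw [Cardinal.mk_Ioi_real] at this
  exact absurd this (not_le.2 Cardinal.aleph0_lt_continuum)

end
end HType

-- The two implications

section
variable {ι : Type} [DecidableEq ι] {d : ι → ℕ}

theorem compositionAdmissible_of_contractionAdmissible (hd : ∀ i, 0 < d i) {x y : HType ι}
    {l : List ι} (hl : l.Nodup) (hlH : l.toFinset = x.ele ∩ y.ele)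
    (h : ContractionAdmissible (Sum.elim d d) (HType.disjointTensor x y)
      (l.map fun a => (.inl a, .inr a))) : CompositionAdmissible d x y := by
  intro R hR S hS
  have hd' : ∀ k, 0 < Sum.elim d d k := by rintro (i | i) <;> exact hd i
  obtain ⟨hRs, M, hM, hMa, hRM⟩ := (mem_T1_iff hd).1 hR
  obtain ⟨hSs, N, hN, hNa, hSN⟩ := (mem_T1_iff hd).1 hS
  obtain rfl : R = x.label M :=
    LabelledOp.ext_ev hd hRs fun c c' => by rw [hRM, HType.label_ev]
  obtain rfl : S = y.label N :=
    LabelledOp.ext_ev hd hSs fun c c' => by rw [hSN, HType.label_ev]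
  obtain ⟨hs, hev⟩ := (HType.isProduct_label_disjointTensorOp M N).contractAll hl hlH
  obtain ⟨z, hz, hzT⟩ := h _ (HType.label_mem_T1 hd' (HType.disjointTensorOp_posSemidef hM hN)
    (HType.disjointTensorOp_mem_aff hMa hNa))
  have hzs := ((mem_T1_iff hd').1 hzT).1
  -- The labels of `z` are those of the uncontracted systems, one copy of each, so `z` can be
  -- renamed back to labels in `ι`.
  obtain ⟨z, rfl⟩ := HType.exists_relabel_eq (splitEmbedding (x.label M).supp) z fun k hk => by
    rw [← hzs, hs] at hk
    obtain ⟨i, -, rfl⟩ := Finset.mem_map.1 hk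
    exact ⟨i, rfl⟩
  exact ⟨z, (HType.labelsDistinct_relabel _ z).1 hz,
    (HType.mem_T1_relabel_iff (sumElim_splitEmbedding d _) hd hd' hs hev).1 hzT⟩

theorem contractionAdmissible_of_compositionAdmissible (hd : ∀ i, 0 < d i) {x y : HType ι}
    {l : List ι} (hl : l.Nodup) (hlH : l.toFinset = x.ele ∩ y.ele)
    (h : CompositionAdmissible d x y) :
    ContractionAdmissible (Sum.elim d d) (HType.disjointTensor x y)
      (l.map fun a => (.inl a, .inr a)) := by
  intro W hW
  have hd' : ∀ k, 0 < Sum.elim d d k := by rintro (i | i) <;> exact hd i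
  obtain ⟨hWs, M, hM, hMa, hWM⟩ := (mem_T1_iff hd').1 hW
  obtain ⟨n, w, R, S, hw, hR, hS, hMRS⟩ := HType.exists_eq_sum_disjointTensorOp hd hMa
  have hn : 0 < n := Nat.pos_of_ne_zero fun h0 => by subst h0; simp at hw
  -- A common type for all the pairs is sought on the two curves, which stay deterministic for `t >
  -- 0` by convexity.
  obtain ⟨z, hz, hT⟩ := HType.exists_infinite_link_mem_T1 h
    (R := fun t => x.label (∑ i, (HType.curveWeight (fun k : Fin n => (k : ℕ)) t i : ℂ) • R i))
    (S := fun t => y.label (∑ j, (HType.curveWeight (fun k : Fin n => n * k) t j : ℂ) • S j))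
    (fun t ht => let h := HType.sum_curveWeight_smul_posSemidef_mem_aff hn _ ht hR
      HType.label_mem_T1 hd h.1 h.2)
    (fun t ht => let h := HType.sum_curveWeight_smul_posSemidef_mem_aff hn _ ht hS
      HType.label_mem_T1 hd h.1 h.2)
  have hzs : (x.ele ∪ y.ele) \ (x.ele ∩ y.ele) = z.ele := by
    obtain ⟨t, -, ht⟩ := hT.nonempty
    exact ((mem_T1_iff hd).1 ht).1
  choose sec hsec using HType.exists_readTotal_eq hd z hz
  have hN := HType.link_mem_aff_of_infinite hd hn hsec hT (fun t ht => ht.1) (fun t ht => ht.2)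
  -- The candidate for the contraction of `W`, up to renaming. Only the diagonal pairs `(R k, S k)`
  -- enter.
  let N : Matrix (HType.Idx d z) (HType.Idx d z) ℂ := ∑ k, w k •
    Matrix.of fun p q => (link (x.label (R k)) (y.label (S k))).ev (sec p) (sec q)
  have hNa : N ∈ HType.aff d z := HType.sum_smul_mem_aff _ hw fun k _ => hN k k
  obtain rfl : W = (HType.disjointTensor x y).label M :=
    LabelledOp.ext_ev hd' hWs fun c c' => by rw [hWM, HType.label_ev]
  have hmem : ∀ a ∈ l, a ∈ x.ele ∧ a ∈ y.ele := fun a ha => by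
    rw [← Finset.mem_inter, ← hlH]; exact List.mem_toFinset.2 ha
  have hsup : ∀ a ∈ l, Sum.inl a ∈ (HType.disjointTensor x y).ele ∧
      Sum.inr a ∈ (HType.disjointTensor x y).ele := fun a ha =>
    ⟨((HType.isProduct_label_disjointTensorOp (R ⟨0, hn⟩) (S ⟨0, hn⟩)).supp (.inl a)).2
      (hmem a ha).1,
    ((HType.isProduct_label_disjointTensorOp (R ⟨0, hn⟩) (S ⟨0, hn⟩)).supp (.inr a)).2
      (hmem a ha).2⟩
  have hcon := fun M : Matrix (HType.Idx (Sum.elim d d) (HType.disjointTensor x y))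
      (HType.Idx (Sum.elim d d) (HType.disjointTensor x y)) ℂ => contractAll_supp_and_ev ((HType.disjointTensor x y).label M) l hl hsup
  have hprod := fun k =>
    (HType.isProduct_label_disjointTensorOp (R k) (S k)).contractAll hl hlH
  have hsupp : (contractAll (l.map fun a => (.inl a, .inr a))
      ((HType.disjointTensor x y).label M)).supp =
        (z.label N).supp.map (splitEmbedding x.ele) := by
    have h1 : ((x.ele ∪ y.ele) \ (x.ele ∩ y.ele)).map (splitEmbedding x.ele) =
      (z.label N).supp.map (splitEmbedding x.ele) := congrArg _ hzs
    rw [← h1]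
    refine Eq.trans ?_ (hprod ⟨0, hn⟩).1
    ext k
    rw [(hcon _).1, (hcon _).1]
    rfl
  have hev : ∀ c c', (contractAll (l.map fun a => (.inl a, .inr a))
      ((HType.disjointTensor x y).label M)).ev c c' =
        (z.label N).ev (c.pull (sumElim_splitEmbedding d x.ele))
          (c'.pull (sumElim_splitEmbedding d x.ele)) := by
    intro c c'
    have h1 : (contractAll (l.map fun a => (.inl a, .inr a))
        ((HType.disjointTensor x y).label M)).ev c c' =
        ∑ k, w k * (contractAll (l.map fun a => (.inl a, .inr a))
          ((HType.disjointTensor x y).label (HType.disjointTensorOp (R k) (S k)))).ev c c' := by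
      simp only [(hcon _).2, HType.label_ev, hMRS, Finset.mul_sum]
      refine (Finset.sum_congr rfl fun h _ => Finset.sum_comm).trans Finset.sum_comm
    rw [h1, HType.label_ev]
    simp only [N, Matrix.sum_apply, Matrix.smul_apply, Matrix.of_apply, smul_eq_mul]
    refine Finset.sum_congr rfl fun k _ => ?_
    rw [(hprod k).2]
    have h2 : ∀ (c : TotalCfg d), ∀ i ∈ (link (x.label (R k)) (y.label (S k))).supp,
        c i = sec (z.readTotal c) i := fun c i hi =>
      HType.eq_of_readTotal_eq z (hsec _).symm i (hzs ▸ hi)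
    exact congrArg (w k * ·) (LabelledOp.ev_congr _ (h2 _) (h2 _))
  -- The weights `w k` need not be nonnegative or even real, so positivity is read off from the
  -- contraction of the positive operator `M`.
  have hNp : N.PosSemidef := by
    choose lift hlift using fun c : TotalCfg d =>
      TotalCfg.exists_pull_eq hd' (sumElim_splitEmbedding d x.ele) c
    have h1 := hM.sum_sum_apply (fun (p : HType.Idx d z) (h : Cfg d l.toFinset) =>
      (HType.disjointTensor x y).readTotal ((lift (sec p)).overwriteBoth h))
    refine (congrArg Matrix.PosSemidef ?_).mpr h1
    refine Matrix.ext fun p q => ?_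
    have h2 := hev (lift (sec p)) (lift (sec q))
    rw [hlift, hlift, HType.label_ev, hsec, hsec, (hcon _).2] at h2
    simp only [HType.label_ev] at h2
    exact h2.symm
  exact ⟨z.relabel (splitEmbedding x.ele), (HType.labelsDistinct_relabel _ z).2 hz,
    (HType.mem_T1_relabel_iff (sumElim_splitEmbedding d _) hd hd' hsupp hev).2
      (HType.label_mem_T1 hd hNp hNa)⟩

end

theorem mainTheorem6 {ι : Type} [DecidableEq ι] (d : ι → ℕ) (hd : ∀ i, 2 ≤ d i)
    (x y : HType ι) (hx : x.LabelsDistinct) (hy : y.LabelsDistinct)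
    (L : List ((ι ⊕ ι) × (ι ⊕ ι))) (hL : L.Nodup) (hLH : L.toFinset = sharedPairs x y) :
    CompositionAdmissible d x y ↔
      ContractionAdmissible (Sum.elim d d) (HType.disjointTensor x y) L := by
  have hd0 : ∀ i, 0 < d i := fun i => lt_of_lt_of_le two_pos (hd i)
  -- `L` is an arbitrary enumeration of the shared pairs, which covers every order of contraction.
  obtain ⟨l, hl, hlH, rfl⟩ := exists_list_of_toFinset_eq_sharedPairs hL hLH
  exact ⟨contractionAdmissible_of_compositionAdmissible hd0 hl hlH,
    compositionAdmissible_of_contractionAdmissible hd0 hl hlH⟩
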